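/- Let $r_0>0$ and $0<L_0\le 1$ be constants, let $I,J\subseteq\mathbb R$ be open sets (for instance intervals), and let $\xi:I\to\mathbb R$, $h:J\to\mathbb R$ be smooth and nowhere zero. On $M=\mathbb R\times I\times J\times\mathbb R$ with coordinates $(t,r,\theta,\phi)$ consider the metric $$g=\frac{r_0^2}{L_0}\bigl(-\xi(r)^2dt^2+dr^2\bigr)+r_0^2\bigl(d\theta^2+h(\theta)^2d\phi^2\bigr).$$ **Notation** (with $n=4$). $\nabla$ is the Levi-Civita connection; $R^s_{pqr}$, given by $R^s_{pqr}\partial_s=(\nabla_q\nabla_p-\nabla_p\nabla_q)\partial_r$, is the Riemann tensor (the opposite sign of $R$ leads to the same assertions), and $R_{pqrs}=g_{st}R^t_{pqr}$; $S_{qr}=R^s_{sqr}$ is the Ricci tensor, $S^t_p=g^{ts}S_{sp}$, $\kappa=S^t_t$. The conformal, projective and concircular curvature tensors are $$C_{pqrs}=R_{pqrs}-\tfrac1{n-2}(g_{ps}S_{qr}-g_{qs}S_{pr}+S_{ps}g_{qr}-S_{qs}g_{pr})+\tfrac{\kappa}{(n-1)(n-2)}(g_{ps}g_{qr}-g_{qs}g_{pr}),$$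 $$P_{pqrs}=R_{pqrs}-\tfrac1{n-1}(g_{ps}S_{qr}-g_{qs}S_{pr}),\qquad W_{pqrs}=R_{pqrs}-\tfrac{\kappa}{n(n-1)}(g_{ps}g_{qr}-g_{qs}g_{pr}).$$ For symmetric $(0,2)$-tensors, $(E\wedge A)_{pqrs}=E_{ps}A_{qr}-E_{pr}A_{qs}+E_{qr}A_{ps}-E_{qs}A_{pr}$. For $(0,4)$-tensors $U,T$ and a $(0,2)$-tensor $Z$, $$(U\cdot T)_{p_1p_2p_3p_4rs}=-g^{\alpha\beta}\bigl[U_{rsp_1\beta}T_{\alpha p_2p_3p_4}+\dots+U_{rsp_4\beta}T_{p_1p_2p_3\alpha}\bigr],$$ $$Q(Z,T)_{p_1p_2p_3p_4rs}=Z_{sp_1}T_{rp_2p_3p_4}+\dots+Z_{sp_4}T_{p_1p_2p_3r}-Z_{rp_1}T_{sp_2p_3p_4}-\dots-Z_{rp_4}T_{p_1p_2p_3s}.$$ Let $U_S=\{L_0h\xi''-\xi h''\ne0\}\subseteq M$ and $U_C=\{L_0h\xi''+\xi h''\neq0\}\subseteq M$, and let $V\subseteq U_S$ be the set of points $(t,r,\theta,\phi)\in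 U_S$ such that $\xi''$ is either nonzero at $r$ or identically zero near $r$, and $h''$ is either nonzero at $\theta$ or identically zero near $\theta$. **Theorem.** In the following, all scalar functions and one-forms are smooth on the indicated set. (i) On $M$: $g$ is semisymmetric, $R\cdot R=0$, and pseudosymmetric due to the conformal curvature tensor: $C\cdot R=\mathcal J\,Q(g,R)$ for some function $\mathcal J$. (ii) On $U_S$, $g$ is 2-quasi-Einstein: $S-\alpha g$ has rank $2$ everywhere for some function $\alpha$. On $M$, $g$ is generalized quasi-Einstein: $S=\alpha g+\beta\,\eta\otimes\eta+\gamma(\eta\otimes\delta+\delta\otimes\eta)$ for some functions $\alpha,\beta,\gamma$ and one-forms $\eta,\delta$ with $\beta,\gamma,\eta,\delta$ nowhere zero. On $U_S$, $g$ is of Roter type: $R=\mu_1\,g\wedge g+\mu_2\,g\wedge S+\mu_3\,S\wedge S$ for some functions $\mu_i$. (iii) On $V$, $g$ is special $SGK_4$: $\nabla R=\Pi\otimes R+\Phi\otimes(S\wedge S)+\Theta\otimes(g\wedge g)$ for some one-forms $\Pi,\Phi,\Theta$. On $U_S$, $g$ is $P$-$SGK_4$: $\nabla P=\Pi\otimes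 P+\Phi\otimes(S\wedge S)+\Psi\otimes(g\wedge S)+\Theta\otimes(g\wedge g)$ for some one-forms $\Pi,\Phi,\Psi,\Theta$. (iv) On $U_C$, $g$ is $C$-$K_4$: $\nabla C=\Pi\otimes C$ for some one-form $\Pi$. On $V$, $g$ is special $W$-$SGK_4$: $\nabla W=\Pi\otimes W+\Phi\otimes(S\wedge S)+\Theta\otimes(g\wedge g)$ for some one-forms $\Pi,\Phi,\Theta$. (v) On $M$, the Ricci tensor is Riemann compatible and projectively compatible: for $B=R$ and $B=P$, $\;S^t_pB_{qrst}+S^t_qB_{rpst}+S^t_rB_{pqst}=0$. -/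

import Mathlib

open scoped ContDiff

noncomputable section

namespace SemiRiem

/-! Tensor calculus in one coordinate chart: a point is its coordinate vector in `Fin n → ℝ`, and a
tensor field is given by its components with respect to the coordinate frame. -/

abbrev Pt (n : ℕ) := Fin n → ℝ

abbrev ScalarField (n : ℕ) := Pt n → ℝ

abbrev CovectorField (n : ℕ) := Pt n → Fin n → ℝ

/-- `(0,2)`-tensor fields. -/
abbrev Tensor2 (n : ℕ) := Pt n → Matrix (Fin n) (Fin n) ℝ

/-- `(0,4)`-tensor fields. -/
abbrev Tensor4 (n : ℕ) := Pt n → Fin n → Fin n → Fin n → Fin n → ℝ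

variable {n : ℕ}

/-- The coordinate partial derivative `∂_i f`. -/
def pderiv (i : Fin n) (f : ScalarField n) : ScalarField n :=
  fun x => fderiv ℝ f x (Pi.single i 1)

/-- Christoffel symbols `Γ^k_{ij}` of the Levi-Civita connection of `g`. -/
def christoffel (g : Tensor2 n) (k i j : Fin n) : ScalarField n := fun x =>
  (1 / 2) * ∑ l, (g x)⁻¹ k l *
    (pderiv i (fun y => g y j l) x + pderiv j (fun y => g y i l) x - pderiv l (fun y => g y i j) x)

/-- Components `R^s_{pqr}` of the Riemann curvature, `R^s_{pqr} ∂_s = (∇_q ∇_p - ∇_p ∇_q) ∂_r`.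
(Replacing `R` by `-R` changes the sign of all curvature tensors below and affects none of the
curvature conditions defined below.) -/
def riemannUp (g : Tensor2 n) (s p q r : Fin n) : ScalarField n := fun x =>
  pderiv q (christoffel g s p r) x - pderiv p (christoffel g s q r) x
    + ∑ m, (christoffel g m p r x * christoffel g s q m x
      - christoffel g m q r x * christoffel g s p m x)

/-- `R_{pqrs} = g_{st} R^t_{pqr}`. -/
def riemann (g : Tensor2 n) : Tensor4 n := fun x p q r s =>
  ∑ t, g x s t * riemannUp g t p q r x

/-- The Ricci tensor `S_{qr} = R^s_{sqr}`. -/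
def ricci (g : Tensor2 n) : Tensor2 n := fun x =>
  Matrix.of fun q r => ∑ s, riemannUp g s s q r x

/-- The Ricci operator `S^t_p = g^{ts} S_{sp}`. -/
def ricciOp (g : Tensor2 n) : Tensor2 n := fun x => (g x)⁻¹ * ricci g x

/-- The scalar curvature `κ`. -/
def scalarCurv (g : Tensor2 n) : ScalarField n := fun x => (ricciOp g x).trace

/-- The conformal (Weyl) curvature tensor. -/
def conformal (g : Tensor2 n) : Tensor4 n := fun x p q r s =>
  riemann g x p q r s
    - 1 / ((n : ℝ) - 2) * (g x p s * ricci g x q r - g x q s * ricci g x p r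
      + ricci g x p s * g x q r - ricci g x q s * g x p r)
    + scalarCurv g x / (((n : ℝ) - 1) * ((n : ℝ) - 2)) * (g x p s * g x q r - g x q s * g x p r)

/-- The projective curvature tensor. -/
def projective (g : Tensor2 n) : Tensor4 n := fun x p q r s =>
  riemann g x p q r s
    - 1 / ((n : ℝ) - 1) * (g x p s * ricci g x q r - g x q s * ricci g x p r)

/-- The concircular curvature tensor. -/
def concircular (g : Tensor2 n) : Tensor4 n := fun x p q r s =>
  riemann g x p q r s
    - scalarCurv g x / ((n : ℝ) * ((n : ℝ) - 1)) * (g x p s * g x q r - g x q s * g x p r)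

/-- The covariant derivative `∇_a T_{pqrs}`. -/
def covDeriv (g : Tensor2 n) (T : Tensor4 n) (x : Pt n) (a p q r s : Fin n) : ℝ :=
  pderiv a (fun y => T y p q r s) x
    - ∑ m, (christoffel g m a p x * T x m q r s + christoffel g m a q x * T x p m r s
      + christoffel g m a r x * T x p q m s + christoffel g m a s x * T x p q r m)

/-- The Kulkarni-Nomizu product `(E ∧ A)_{pqrs}` of two symmetric `(0,2)`-tensors. -/
def kulkarniNomizu (E A : Tensor2 n) : Tensor4 n := fun x p q r s =>
  E x p s * A x q r - E x p r * A x q s + E x q r * A x p s - E x q s * A x p r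

/-- The `(0,6)`-tensor `(U · T)_{pqklrs}` for `(0,4)`-tensors `U` and `T`. -/
def dotTensor (g : Tensor2 n) (U T : Tensor4 n) (x : Pt n) (p q k l r s : Fin n) : ℝ :=
  -∑ a, ∑ b, (g x)⁻¹ a b *
    (U x r s p b * T x a q k l + U x r s q b * T x p a k l
      + U x r s k b * T x p q a l + U x r s l b * T x p q k a)

/-- The `(0,6)`-tensor `Q(Z, T)_{pqklrs}` for a `(0,2)`-tensor `Z` and a `(0,4)`-tensor `T`. -/
def tachibana (Z : Tensor2 n) (T : Tensor4 n) (x : Pt n) (p q k l r s : Fin n) : ℝ :=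
  Z x s p * T x r q k l + Z x s q * T x p r k l + Z x s k * T x p q r l + Z x s l * T x p q k r
    - Z x r p * T x s q k l - Z x r q * T x p s k l - Z x r k * T x p q s l - Z x r l * T x p q k s

/-! The curvature conditions, on an open set `V` of the chart. -/

/-- `T`-semisymmetric due to `U`: `U · T = 0`. -/
def IsSemisymmetricOn (g : Tensor2 n) (U T : Tensor4 n) (V : Set (Pt n)) : Prop :=
  ∀ x ∈ V, ∀ p q k l r s, dotTensor g U T x p q k l r s = 0

/-- `T`-pseudosymmetric type due to `U`: `U · T = 𝒥 Q(Z, T)` for a scalar function `𝒥`. -/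
def IsPseudosymmetricOn (g : Tensor2 n) (U : Tensor4 n) (Z : Tensor2 n) (T : Tensor4 n)
    (V : Set (Pt n)) : Prop :=
  ∃ 𝒥 : ScalarField n, ContDiffOn ℝ ∞ 𝒥 V ∧
    ∀ x ∈ V, ∀ p q k l r s, dotTensor g U T x p q k l r s = 𝒥 x * tachibana Z T x p q k l r s

/-- `m`-quasi-Einstein: `S - α g` has rank `m` for a scalar function `α`. -/
def IsQuasiEinsteinOn (m : ℕ) (g : Tensor2 n) (V : Set (Pt n)) : Prop :=
  ∃ α : ScalarField n, ContDiffOn ℝ ∞ α V ∧ ∀ x ∈ V, (ricci g x - α x • g x).rank = m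

/-- Generalized quasi-Einstein: `S = α g + β η ⊗ η + γ (η ⊗ δ + δ ⊗ η)` with scalar functions
`α, β, γ` and one-forms `η, δ`, where `β, γ, η, δ` vanish nowhere. -/
def IsGenQuasiEinsteinOn (g : Tensor2 n) (V : Set (Pt n)) : Prop :=
  ∃ (α β γ : ScalarField n) (η δ : CovectorField n),
    ContDiffOn ℝ ∞ α V ∧ ContDiffOn ℝ ∞ β V ∧ ContDiffOn ℝ ∞ γ V ∧
    ContDiffOn ℝ ∞ η V ∧ ContDiffOn ℝ ∞ δ V ∧
    ∀ x ∈ V, β x ≠ 0 ∧ γ x ≠ 0 ∧ η x ≠ 0 ∧ δ x ≠ 0 ∧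
      ∀ p q, ricci g x p q =
        α x * g x p q + β x * (η x p * η x q) + γ x * (η x p * δ x q + δ x p * η x q)

/-- Roter type: `R = μ₁ g ∧ g + μ₂ g ∧ S + μ₃ S ∧ S` with scalar functions `μ₁, μ₂, μ₃`. -/
def IsRoterTypeOn (g : Tensor2 n) (V : Set (Pt n)) : Prop :=
  ∃ μ₁ μ₂ μ₃ : ScalarField n,
    ContDiffOn ℝ ∞ μ₁ V ∧ ContDiffOn ℝ ∞ μ₂ V ∧ ContDiffOn ℝ ∞ μ₃ V ∧
    ∀ x ∈ V, ∀ p q r s, riemann g x p q r s =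
      μ₁ x * kulkarniNomizu g g x p q r s + μ₂ x * kulkarniNomizu g (ricci g) x p q r s
        + μ₃ x * kulkarniNomizu (ricci g) (ricci g) x p q r s

/-- `T`-`K_n`, `T`-recurrent: `∇T = Π ⊗ T`. -/
def IsRecurrentOn (g : Tensor2 n) (T : Tensor4 n) (V : Set (Pt n)) : Prop :=
  ∃ ϖ : CovectorField n, ContDiffOn ℝ ∞ ϖ V ∧
    ∀ x ∈ V, ∀ a p q r s, covDeriv g T x a p q r s = ϖ x a * T x p q r s

/-- `T`-`SGK_n`, `T`-super generalized recurrent: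
`∇T = Π ⊗ T + Φ ⊗ (S ∧ S) + Ψ ⊗ (g ∧ S) + Θ ⊗ (g ∧ g)`. -/
def IsSuperGenRecurrentOn (g : Tensor2 n) (T : Tensor4 n) (V : Set (Pt n)) : Prop :=
  ∃ ϖ Φ Ψ Θ : CovectorField n,
    ContDiffOn ℝ ∞ ϖ V ∧ ContDiffOn ℝ ∞ Φ V ∧ ContDiffOn ℝ ∞ Ψ V ∧ ContDiffOn ℝ ∞ Θ V ∧
    ∀ x ∈ V, ∀ a p q r s, covDeriv g T x a p q r s =
      ϖ x a * T x p q r s + Φ x a * kulkarniNomizu (ricci g) (ricci g) x p q r s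
        + Ψ x a * kulkarniNomizu g (ricci g) x p q r s + Θ x a * kulkarniNomizu g g x p q r s

/-- Special `T`-`SGK_n`: super generalized recurrent with `Ψ = 0`. -/
def IsSpecialSuperGenRecurrentOn (g : Tensor2 n) (T : Tensor4 n) (V : Set (Pt n)) : Prop :=
  ∃ ϖ Φ Θ : CovectorField n,
    ContDiffOn ℝ ∞ ϖ V ∧ ContDiffOn ℝ ∞ Φ V ∧ ContDiffOn ℝ ∞ Θ V ∧
    ∀ x ∈ V, ∀ a p q r s, covDeriv g T x a p q r s =
      ϖ x a * T x p q r s + Φ x a * kulkarniNomizu (ricci g) (ricci g) x p q r s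
        + Θ x a * kulkarniNomizu g g x p q r s

/-- The Ricci tensor is `B`-compatible: the cyclic sum over `p, q, r` of `S^t_p B_{qrst}` is `0`. -/
def IsRicciCompatibleOn (g : Tensor2 n) (B : Tensor4 n) (V : Set (Pt n)) : Prop :=
  ∀ x ∈ V, ∀ p q r s,
    ∑ t, (ricciOp g x t p * B x q r s t + ricciOp g x t q * B x r p s t
      + ricciOp g x t r * B x p q s t) = 0

/-- The metric `(r₀² / L₀) (-ξ(r)² dt² + dr²) + r₀² (dθ² + h(θ)² dφ²)` in the coordinates
`(x 0, x 1, x 2, x 3) = (t, r, θ, φ)`. -/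
def cntm (r₀ L₀ : ℝ) (ξ h : ℝ → ℝ) : Tensor2 4 := fun x =>
  Matrix.diagonal ![-(r₀ ^ 2 / L₀ * ξ (x 1) ^ 2), r₀ ^ 2 / L₀, r₀ ^ 2, r₀ ^ 2 * h (x 2) ^ 2]

/-- The coordinate domain `ℝ × I × J × ℝ`. -/
def chartDomain (I J : Set ℝ) : Set (Pt 4) := {x | x 1 ∈ I ∧ x 2 ∈ J}

/-- `L₀ h ξ'' - ξ h''`; its zeros are the points where `S` is a multiple of `g`. -/
def einsteinDefect (L₀ : ℝ) (ξ h : ℝ → ℝ) : ScalarField 4 := fun x =>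
  L₀ * h (x 2) * deriv (deriv ξ) (x 1) - ξ (x 1) * deriv (deriv h) (x 2)

/-- `L₀ h ξ'' + ξ h''`; its zeros are the points where the conformal curvature vanishes. -/
def weylFactor (L₀ : ℝ) (ξ h : ℝ → ℝ) : ScalarField 4 := fun x =>
  L₀ * h (x 2) * deriv (deriv ξ) (x 1) + ξ (x 1) * deriv (deriv h) (x 2)

/-- At `s` the function `f` is either nonzero or identically zero on a neighbourhood of `s`. -/
def NonzeroOrLocallyZeroAt (f : ℝ → ℝ) (s : ℝ) : Prop :=
  f s ≠ 0 ∨ ∀ᶠ s' in nhds s, f s' = 0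

end SemiRiem

end

/-! The metric is a product of two surfaces: g = E + F, where E and F are the metrics of the (t,r)
and (θ,φ) factors extended by zero (`firstBlock`, `secondBlock`). Put κ₁ = L₀ξ''/(r₀²ξ) and κ₂ =
h''/(r₀²h), functions of r alone and of θ alone. Write XY for X_{ps}Y_{qr} - X_{qs}Y_{pr}
(`halfWedge`). Then R = κ₁ EE + κ₂ FF and S = κ₁ E + κ₂ F, so every tensor in the theorem is a
combination of EE, EF, FE, FF with coefficients polynomial in κ₁, κ₂ (`riemann_cntm`, `ricci_cntm`
and their consequences).

Two facts reduce everything to comparing four coefficients. Both blocks are parallel, so ∇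
differentiates only the coefficients (`covDeriv_cntm`). In U · R the parts EE and FF of U act as
infinitesimal rotations of one factor, which fix E and F and hence R; U may thus be replaced by a
multiple of the g-analogue EE + EF + FE + FF, whose action on R is -Q(g,R) (`dotTensor_of_blocks`).

The sets in the theorem say when the linear systems for the coefficients are solvable: U_S is κ₁ ≠
κ₂, U_C is κ₁ + κ₂ ≠ 0, and on V the logarithmic derivatives of κ₁ and κ₂ make sense. -/

namespace SemiRiem
variable {n : ℕ}

/-! ### Partial derivatives -/

theorem pderiv_congr {f f' : ScalarField n} {x : Pt n} (i : Fin n) (hf : f =ᶠ[nhds x] f') :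
    pderiv i f x = pderiv i f' x := by
  simp only [pderiv, hf.fderiv_eq]

theorem pderiv_add {f f' : ScalarField n} {x : Pt n} (i : Fin n) (hf : DifferentiableAt ℝ f x)
    (hf' : DifferentiableAt ℝ f' x) :
    pderiv i (fun y => f y + f' y) x = pderiv i f x + pderiv i f' x := by
  simp only [pderiv, fderiv_fun_add hf hf', add_apply]

theorem pderiv_sub {f f' : ScalarField n} {x : Pt n} (i : Fin n) (hf : DifferentiableAt ℝ f x)
    (hf' : DifferentiableAt ℝ f' x) :
    pderiv i (fun y => f y - f' y) x = pderiv i f x - pderiv i f' x := by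
  simp only [pderiv, fderiv_fun_sub hf hf', sub_apply]

theorem pderiv_mul {f f' : ScalarField n} {x : Pt n} (i : Fin n) (hf : DifferentiableAt ℝ f x)
    (hf' : DifferentiableAt ℝ f' x) :
    pderiv i (fun y => f y * f' y) x = f x * pderiv i f' x + pderiv i f x * f' x := by
  simp only [pderiv, fderiv_fun_mul hf hf', add_apply,
    smul_apply, smul_eq_mul]
  ring

theorem differentiableAt_comp_coord {f : ℝ → ℝ} {j : Fin n} {x : Pt n}
    (hf : DifferentiableAt ℝ f (x j)) : DifferentiableAt ℝ (fun y : Pt n => f (y j)) x :=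
  DifferentiableAt.comp x hf (differentiableAt_apply j x)

theorem pderiv_comp_coord {f : ℝ → ℝ} {f' : ℝ} {j : Fin n} {x : Pt n}
    (hf : HasDerivAt f f' (x j)) (i : Fin n) :
    pderiv i (fun y => f (y j)) x = if i = j then f' else 0 := by
  have h1 : HasFDerivAt (fun y : Pt n => f (y j))
      (f' • (ContinuousLinearMap.proj j : Pt n →L[ℝ] ℝ)) x :=
    hf.comp_hasFDerivAt x (hasFDerivAt_apply j x)
  simp only [pderiv, h1.fderiv]
  simp [Pi.single_apply, eq_comm]

/-! ### Parallel tensors -/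

/-- `E_{ps} A_{qr} - E_{qs} A_{pr}`. -/
def halfWedge (E A : Matrix (Fin n) (Fin n) ℝ) (p q r s : Fin n) : ℝ :=
  E p s * A q r - E q s * A p r

/-- `E` is differentiable at `x` and `∇E = 0` at `x`. -/
def IsParallelAt (g E : Tensor2 n) (x : Pt n) : Prop :=
  ∀ p q, DifferentiableAt ℝ (fun y => E y p q) x ∧
    ∀ a, pderiv a (fun y => E y p q) x =
      ∑ m, (christoffel g m a p x * E x m q + christoffel g m a q x * E x p m)

theorem covDeriv_congr (g : Tensor2 n) {T T' : Tensor4 n} {x : Pt n} (hT : T =ᶠ[nhds x] T')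
    (a p q r s : Fin n) : covDeriv g T x a p q r s = covDeriv g T' x a p q r s := by
  have h1 : (fun y => T y p q r s) =ᶠ[nhds x] fun y => T' y p q r s := by
    filter_upwards [hT] with y hy
    rw [hy]
  simp only [covDeriv, pderiv_congr a h1, hT.eq_of_nhds]

theorem covDeriv_add (g : Tensor2 n) {T T' : Tensor4 n} {x : Pt n}
    (hT : ∀ p q r s, DifferentiableAt ℝ (fun y => T y p q r s) x)
    (hT' : ∀ p q r s, DifferentiableAt ℝ (fun y => T' y p q r s) x) (a p q r s : Fin n) :
    covDeriv g (fun y p q r s => T y p q r s + T' y p q r s) x a p q r s =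
      covDeriv g T x a p q r s + covDeriv g T' x a p q r s := by
  simp only [covDeriv, pderiv_add a (hT p q r s) (hT' p q r s), mul_add, Finset.sum_add_distrib]
  ring

theorem IsParallelAt.differentiableAt_halfWedge {g E A : Tensor2 n} {x : Pt n}
    (hE : IsParallelAt g E x) (hA : IsParallelAt g A x) (p q r s : Fin n) :
    DifferentiableAt ℝ (fun y => halfWedge (E y) (A y) p q r s) x :=
  (((hE p s).1.fun_mul (hA q r).1).sub ((hE q s).1.fun_mul (hA p r).1))

/-- By the Leibniz rule a product of parallel tensors is parallel (`key`), so its Christoffel terms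
cancel and only the derivative of f survives. -/
theorem IsParallelAt.covDeriv_mul_halfWedge {g E A : Tensor2 n} {x : Pt n}
    (hE : IsParallelAt g E x) (hA : IsParallelAt g A x) {f : ScalarField n}
    (hf : DifferentiableAt ℝ f x) (a p q r s : Fin n) :
    covDeriv g (fun y p q r s => f y * halfWedge (E y) (A y) p q r s) x a p q r s =
      pderiv a f x * halfWedge (E x) (A x) p q r s := by
  have key : pderiv a (fun y => halfWedge (E y) (A y) p q r s) x =
      ∑ m, (christoffel g m a p x * halfWedge (E x) (A x) m q r s
        + christoffel g m a q x * halfWedge (E x) (A x) p m r s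
        + christoffel g m a r x * halfWedge (E x) (A x) p q m s
        + christoffel g m a s x * halfWedge (E x) (A x) p q r m) := by
    simp only [halfWedge]
    rw [pderiv_sub a ((hE p s).1.fun_mul (hA q r).1) ((hE q s).1.fun_mul (hA p r).1),
      pderiv_mul a (hE p s).1 (hA q r).1, pderiv_mul a (hE q s).1 (hA p r).1,
      (hE p s).2, (hE q s).2, (hA q r).2, (hA p r).2]
    simp only [Finset.mul_sum, Finset.sum_mul, ← Finset.sum_add_distrib, ← Finset.sum_sub_distrib]
    exact Finset.sum_congr rfl fun m _ => by ring
  rw [covDeriv, pderiv_mul a hf (hE.differentiableAt_halfWedge hA p q r s), key]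
  rw [add_comm, add_sub_assoc, add_eq_left, sub_eq_zero, Finset.mul_sum]
  exact Finset.sum_congr rfl fun m _ => by ring

/-- The covariant derivative of a combination of products of two parallel tensors. -/
theorem covDeriv_of_eventuallyEq {g E A : Tensor2 n} {T : Tensor4 n} {x : Pt n}
    (hE : IsParallelAt g E x) (hA : IsParallelAt g A x) {f₁ f₂ f₃ f₄ : ScalarField n}
    (h₁ : DifferentiableAt ℝ f₁ x) (h₂ : DifferentiableAt ℝ f₂ x) (h₃ : DifferentiableAt ℝ f₃ x)
    (h₄ : DifferentiableAt ℝ f₄ x)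
    (hT : ∀ᶠ y in nhds x, ∀ p q r s, T y p q r s =
      f₁ y * halfWedge (E y) (E y) p q r s + f₂ y * halfWedge (E y) (A y) p q r s
        + f₃ y * halfWedge (A y) (E y) p q r s + f₄ y * halfWedge (A y) (A y) p q r s)
    (a p q r s : Fin n) :
    covDeriv g T x a p q r s =
      pderiv a f₁ x * halfWedge (E x) (E x) p q r s + pderiv a f₂ x * halfWedge (E x) (A x) p q r s
        + pderiv a f₃ x * halfWedge (A x) (E x) p q r s
        + pderiv a f₄ x * halfWedge (A x) (A x) p q r s := by
  have hT' : T =ᶠ[nhds x] fun y p q r s =>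
      f₁ y * halfWedge (E y) (E y) p q r s + f₂ y * halfWedge (E y) (A y) p q r s
        + f₃ y * halfWedge (A y) (E y) p q r s + f₄ y * halfWedge (A y) (A y) p q r s := by
    filter_upwards [hT] with y hy
    funext p q r s
    exact hy p q r s
  have d₁ := fun p q r s => h₁.fun_mul (hE.differentiableAt_halfWedge hE p q r s)
  have d₂ := fun p q r s => h₂.fun_mul (hE.differentiableAt_halfWedge hA p q r s)
  have d₃ := fun p q r s => h₃.fun_mul (hA.differentiableAt_halfWedge hE p q r s)
  have d₄ := fun p q r s => h₄.fun_mul (hA.differentiableAt_halfWedge hA p q r s)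
  rw [covDeriv_congr g hT',
    covDeriv_add g (fun p q r s => ((d₁ p q r s).fun_add (d₂ p q r s)).fun_add (d₃ p q r s)) d₄,
    covDeriv_add g (fun p q r s => (d₁ p q r s).fun_add (d₂ p q r s)) d₃,
    covDeriv_add g d₁ d₂, hE.covDeriv_mul_halfWedge hE h₁, hE.covDeriv_mul_halfWedge hA h₂,
    hA.covDeriv_mul_halfWedge hE h₃, hA.covDeriv_mul_halfWedge hA h₄]

/-! ### Curvature of the product of two warped surfaces -/

/-- The first factor of the metric `cntm`, extended by zero. -/
noncomputable def firstBlock (r₀ L₀ : ℝ) (ξ : ℝ → ℝ) (r : ℝ) : Matrix (Fin 4) (Fin 4) ℝ :=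
  Matrix.diagonal ![-(r₀ ^ 2 / L₀ * ξ r ^ 2), r₀ ^ 2 / L₀, 0, 0]

/-- The second factor of the metric `cntm`, extended by zero. -/
def secondBlock (r₀ : ℝ) (h : ℝ → ℝ) (θ : ℝ) : Matrix (Fin 4) (Fin 4) ℝ :=
  Matrix.diagonal ![0, 0, r₀ ^ 2, r₀ ^ 2 * h θ ^ 2]

/-- `f'' / (c f)`; minus the Gaussian curvature of `c (ds² ± f(s)² dt²)`. -/
noncomputable def warpCurv (c : ℝ) (f : ℝ → ℝ) (s : ℝ) : ℝ := deriv (deriv f) s / (c * f s)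

/-- Christoffel symbols of a warped surface with base coordinate `v` and fibre coordinate `u`:
`Γ^u_{uv} = a`, `Γ^v_{uu} = b`. -/
def warpSymbol (u v : Fin 4) (a b : ℝ) (k i j : Fin 4) : ℝ :=
  if k = u ∧ (i = u ∧ j = v ∨ i = v ∧ j = u) then a else if k = v ∧ i = u ∧ j = u then b else 0

/-- Standing assumptions on the data of the metric `cntm`. -/
structure IsWarpedData (r₀ L₀ : ℝ) (I J : Set ℝ) (ξ h : ℝ → ℝ) : Prop where
  r₀_ne : r₀ ≠ 0
  L₀_ne : L₀ ≠ 0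
  isOpen_left : IsOpen I
  isOpen_right : IsOpen J
  contDiffOn_left : ContDiffOn ℝ ∞ ξ I
  contDiffOn_right : ContDiffOn ℝ ∞ h J
  left_ne : ∀ r ∈ I, ξ r ≠ 0
  right_ne : ∀ θ ∈ J, h θ ≠ 0

theorem contDiffOn_deriv {f : ℝ → ℝ} {U : Set ℝ} (hU : IsOpen U) (hf : ContDiffOn ℝ ∞ f U) :
    ContDiffOn ℝ ∞ (deriv f) U :=
  ((contDiffOn_infty_iff_deriv_of_isOpen hU).1 hf).2

theorem hasDerivAt_of_contDiffOn {f : ℝ → ℝ} {U : Set ℝ} (hU : IsOpen U)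
    (hf : ContDiffOn ℝ ∞ f U) {s : ℝ} (hs : s ∈ U) : HasDerivAt f (deriv f s) s :=
  ((hf.differentiableOn (by simp)).differentiableAt (hU.mem_nhds hs)).hasDerivAt

theorem hasDerivAt_matrix_diagonal {v : ℝ → Fin 4 → ℝ} {v' : Fin 4 → ℝ} {s : ℝ}
    (hv : ∀ i, HasDerivAt (fun t => v t i) (v' i) s) (i j : Fin 4) :
    HasDerivAt (fun t => Matrix.diagonal (v t) i j) (Matrix.diagonal v' i j) s := by
  by_cases hij : i = j
  · subst hij
    simpa using hv i
  · simpa [hij] using hasDerivAt_const s (0 : ℝ)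

theorem hasDerivAt_warpSymbol (u v k i j : Fin 4) {a b : ℝ → ℝ} {a' b' s : ℝ}
    (ha : HasDerivAt a a' s) (hb : HasDerivAt b b' s) :
    HasDerivAt (fun t => warpSymbol u v (a t) (b t) k i j) (warpSymbol u v a' b' k i j) s := by
  unfold warpSymbol
  split_ifs
  exacts [ha, hb, hasDerivAt_const s 0]

theorem cntm_eq (r₀ L₀ : ℝ) (ξ h : ℝ → ℝ) (x : Pt 4) :
    cntm r₀ L₀ ξ h x = firstBlock r₀ L₀ ξ (x 1) + secondBlock r₀ h (x 2) := by
  ext i j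
  fin_cases i <;> fin_cases j <;> simp [cntm, firstBlock, secondBlock]

theorem firstBlock_symm (r₀ L₀ : ℝ) (ξ : ℝ → ℝ) (r : ℝ) (i j : Fin 4) :
    firstBlock r₀ L₀ ξ r i j = firstBlock r₀ L₀ ξ r j i := by
  simpa [firstBlock] using congrFun₂ (Matrix.diagonal_transpose
    ![-(r₀ ^ 2 / L₀ * ξ r ^ 2), r₀ ^ 2 / L₀, 0, 0]) j i

theorem secondBlock_symm (r₀ : ℝ) (h : ℝ → ℝ) (θ : ℝ) (i j : Fin 4) :
    secondBlock r₀ h θ i j = secondBlock r₀ h θ j i := by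
  simpa [secondBlock] using congrFun₂ (Matrix.diagonal_transpose
    ![0, 0, r₀ ^ 2, r₀ ^ 2 * h θ ^ 2]) j i

/-! ### Connection and curvature of the metric `cntm` -/

namespace IsWarpedData

variable {r₀ L₀ : ℝ} {I J : Set ℝ} {ξ h : ℝ → ℝ} {x : Pt 4}

theorem isOpen_chartDomain (H : IsWarpedData r₀ L₀ I J ξ h) : IsOpen (chartDomain I J) :=
  (H.isOpen_left.preimage (continuous_apply 1)).inter (H.isOpen_right.preimage (continuous_apply 2))

theorem inv_cntm (H : IsWarpedData r₀ L₀ I J ξ h) (hx : x ∈ chartDomain I J) :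
    (cntm r₀ L₀ ξ h x)⁻¹ = Matrix.diagonal ![-(L₀ / (r₀ ^ 2 * ξ (x 1) ^ 2)), L₀ / r₀ ^ 2,
      1 / r₀ ^ 2, 1 / (r₀ ^ 2 * h (x 2) ^ 2)] := by
  have h1 := H.r₀_ne
  have h2 := H.L₀_ne
  have h3 := H.left_ne _ hx.1
  have h4 := H.right_ne _ hx.2
  apply Matrix.inv_eq_right_inv
  rw [cntm, Matrix.diagonal_mul_diagonal, ← Matrix.diagonal_one]
  congr 1
  funext i
  fin_cases i <;> simp <;> field_simp

theorem hasDerivAt_firstBlock (H : IsWarpedData r₀ L₀ I J ξ h) (hx : x ∈ chartDomain I J)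
    (i j : Fin 4) : HasDerivAt (fun r => firstBlock r₀ L₀ ξ r i j)
      (Matrix.diagonal ![-(r₀ ^ 2 / L₀ * (2 * ξ (x 1) * deriv ξ (x 1))), 0, 0, 0] i j) (x 1) := by
  refine hasDerivAt_matrix_diagonal (fun k => ?_) i j
  have h1 := hasDerivAt_of_contDiffOn H.isOpen_left H.contDiffOn_left hx.1
  fin_cases k
  · simpa using ((h1.pow 2).const_mul (r₀ ^ 2 / L₀)).fun_neg
  all_goals simpa using hasDerivAt_const _ _

theorem hasDerivAt_secondBlock (H : IsWarpedData r₀ L₀ I J ξ h) (hx : x ∈ chartDomain I J)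
    (i j : Fin 4) : HasDerivAt (fun θ => secondBlock r₀ h θ i j)
      (Matrix.diagonal ![0, 0, 0, r₀ ^ 2 * (2 * h (x 2) * deriv h (x 2))] i j) (x 2) := by
  refine hasDerivAt_matrix_diagonal (fun k => ?_) i j
  have h1 := hasDerivAt_of_contDiffOn H.isOpen_right H.contDiffOn_right hx.2
  fin_cases k
  · simpa using hasDerivAt_const _ _
  · simpa using hasDerivAt_const _ _
  · simpa using hasDerivAt_const _ _
  · simpa using (h1.pow 2).const_mul (r₀ ^ 2)

theorem pderiv_cntm (H : IsWarpedData r₀ L₀ I J ξ h) (hx : x ∈ chartDomain I J)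
    (a i j : Fin 4) : pderiv a (fun y => cntm r₀ L₀ ξ h y i j) x =
      (if a = 1 then
        Matrix.diagonal ![-(r₀ ^ 2 / L₀ * (2 * ξ (x 1) * deriv ξ (x 1))), 0, 0, 0] i j else 0)
      + if a = 2 then
        Matrix.diagonal ![0, 0, 0, r₀ ^ 2 * (2 * h (x 2) * deriv h (x 2))] i j else 0 := by
  have h1 := H.hasDerivAt_firstBlock hx i j
  have h2 := H.hasDerivAt_secondBlock hx i j
  simp only [cntm_eq, Matrix.add_apply]
  rw [pderiv_add a (differentiableAt_comp_coord h1.differentiableAt)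
    (differentiableAt_comp_coord h2.differentiableAt), pderiv_comp_coord h1, pderiv_comp_coord h2]

theorem christoffel_cntm (H : IsWarpedData r₀ L₀ I J ξ h) (hx : x ∈ chartDomain I J)
    (k i j : Fin 4) : christoffel (cntm r₀ L₀ ξ h) k i j x =
      warpSymbol 0 1 (deriv ξ (x 1) / ξ (x 1)) (ξ (x 1) * deriv ξ (x 1)) k i j
      + warpSymbol 3 2 (deriv h (x 2) / h (x 2)) (-(h (x 2) * deriv h (x 2))) k i j := by
  have h1 := H.r₀_ne
  have h2 := H.L₀_ne
  have h3 := H.left_ne _ hx.1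
  have h4 := H.right_ne _ hx.2
  simp only [christoffel, H.inv_cntm hx, H.pderiv_cntm hx, Matrix.diagonal_apply, ite_mul, zero_mul,
    Finset.sum_ite_eq, Finset.mem_univ, if_true, warpSymbol]
  fin_cases k <;> fin_cases i <;> fin_cases j <;> simp <;> field_simp

theorem pderiv_christoffel_cntm (H : IsWarpedData r₀ L₀ I J ξ h) (hx : x ∈ chartDomain I J)
    (a k i j : Fin 4) : pderiv a (christoffel (cntm r₀ L₀ ξ h) k i j) x =
      (if a = 1 then warpSymbol 0 1
        ((deriv (deriv ξ) (x 1) * ξ (x 1) - deriv ξ (x 1) * deriv ξ (x 1)) / ξ (x 1) ^ 2)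
        (deriv ξ (x 1) * deriv ξ (x 1) + ξ (x 1) * deriv (deriv ξ) (x 1)) k i j else 0)
      + if a = 2 then warpSymbol 3 2
        ((deriv (deriv h) (x 2) * h (x 2) - deriv h (x 2) * deriv h (x 2)) / h (x 2) ^ 2)
        (-(deriv h (x 2) * deriv h (x 2) + h (x 2) * deriv (deriv h) (x 2))) k i j else 0 := by
  have h1 := hasDerivAt_of_contDiffOn H.isOpen_left H.contDiffOn_left hx.1
  have h1' := hasDerivAt_of_contDiffOn H.isOpen_left
    (contDiffOn_deriv H.isOpen_left H.contDiffOn_left) hx.1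
  have h2 := hasDerivAt_of_contDiffOn H.isOpen_right H.contDiffOn_right hx.2
  have h2' := hasDerivAt_of_contDiffOn H.isOpen_right
    (contDiffOn_deriv H.isOpen_right H.contDiffOn_right) hx.2
  have e1 := hasDerivAt_warpSymbol 0 1 k i j (h1'.div h1 (H.left_ne _ hx.1)) (h1.mul h1')
  have e2 := hasDerivAt_warpSymbol 3 2 k i j (h2'.div h2 (H.right_ne _ hx.2)) (h2.mul h2').neg
  rw [← pderiv_comp_coord e1, ← pderiv_comp_coord e2,
    ← pderiv_add a (differentiableAt_comp_coord e1.differentiableAt)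
      (differentiableAt_comp_coord e2.differentiableAt)]
  -- The closed form of the Christoffel symbols may be differentiated because it holds on the whole
  -- open chart domain, not only at x.
  apply pderiv_congr
  filter_upwards [H.isOpen_chartDomain.mem_nhds hx] with y hy
  exact H.christoffel_cntm hy k i j

/-- The Levi-Civita connection of a product is the sum of those of the factors, and each factor
metric is parallel for its own. -/
theorem isParallelAt_firstBlock (H : IsWarpedData r₀ L₀ I J ξ h) (hx : x ∈ chartDomain I J) :
    IsParallelAt (cntm r₀ L₀ ξ h) (fun y => firstBlock r₀ L₀ ξ (y 1)) x := by
  intro p q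
  have h1 := H.hasDerivAt_firstBlock hx p q
  have h3 := H.left_ne _ hx.1
  refine ⟨differentiableAt_comp_coord h1.differentiableAt, fun a => ?_⟩
  rw [pderiv_comp_coord h1]
  simp only [H.christoffel_cntm hx, warpSymbol, firstBlock, Fin.sum_univ_four]
  fin_cases a <;> fin_cases p <;> fin_cases q <;> simp <;> field_simp <;> ring

theorem isParallelAt_secondBlock (H : IsWarpedData r₀ L₀ I J ξ h) (hx : x ∈ chartDomain I J) :
    IsParallelAt (cntm r₀ L₀ ξ h) (fun y => secondBlock r₀ h (y 2)) x := by
  intro p q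
  have h1 := H.hasDerivAt_secondBlock hx p q
  have h3 := H.right_ne _ hx.2
  refine ⟨differentiableAt_comp_coord h1.differentiableAt, fun a => ?_⟩
  rw [pderiv_comp_coord h1]
  simp only [H.christoffel_cntm hx, warpSymbol, secondBlock, Fin.sum_univ_four]
  fin_cases a <;> fin_cases p <;> fin_cases q <;> simp <;> field_simp <;> ring

-- A surface has curvature determined by one function, and a product has no mixed curvature. The
-- diagonal 0-1 matrices are the projections onto the factors, that is, the blocks with one index
-- raised.
set_option maxHeartbeats 2000000 in
theorem riemannUp_cntm (H : IsWarpedData r₀ L₀ I J ξ h) (hx : x ∈ chartDomain I J)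
    (s p q r : Fin 4) : riemannUp (cntm r₀ L₀ ξ h) s p q r x =
      warpCurv (r₀ ^ 2 / L₀) ξ (x 1) * halfWedge (Matrix.diagonal ![1, 1, 0, 0])
        (firstBlock r₀ L₀ ξ (x 1)) p q r s
      + warpCurv (r₀ ^ 2) h (x 2) * halfWedge (Matrix.diagonal ![0, 0, 1, 1])
        (secondBlock r₀ h (x 2)) p q r s := by
  have h1 := H.r₀_ne
  have h2 := H.L₀_ne
  have h3 := H.left_ne _ hx.1
  have h4 := H.right_ne _ hx.2
  simp only [riemannUp, H.pderiv_christoffel_cntm hx, H.christoffel_cntm hx, warpSymbol, halfWedge,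
    firstBlock, secondBlock, warpCurv, Fin.sum_univ_four]
  fin_cases s <;> fin_cases p <;> fin_cases q <;> fin_cases r <;> simp <;> field_simp <;> ring
end IsWarpedData

/-- `U · T` when `U` and `T` are built from two complementary orthogonal blocks of the metric. -/
theorem dotTensor_of_blocks {n : ℕ} {g : Tensor2 n} {U T : Tensor4 n} {x : Pt n}
    {E F : Matrix (Fin n) (Fin n) ℝ} (hg : g x = E + F)
    (hE : ∀ i j, E i j = E j i) (hF : ∀ i j, F i j = F j i)
    (hEE : ∀ c d, ∑ a, ∑ b, (g x)⁻¹ a b * (E c b * E a d) = E c d)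
    (hEF : ∀ c d, ∑ a, ∑ b, (g x)⁻¹ a b * (E c b * F a d) = 0)
    (hFE : ∀ c d, ∑ a, ∑ b, (g x)⁻¹ a b * (F c b * E a d) = 0)
    (hFF : ∀ c d, ∑ a, ∑ b, (g x)⁻¹ a b * (F c b * F a d) = F c d)
    {u₁ u₂ u₃ k₁ k₂ : ℝ}
    (hU : ∀ p q r s, U x p q r s = u₁ * halfWedge E E p q r s
      + u₂ * (halfWedge E F p q r s + halfWedge F E p q r s) + u₃ * halfWedge F F p q r s)
    (hT : ∀ p q r s, T x p q r s = k₁ * halfWedge E E p q r s + k₂ * halfWedge F F p q r s)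
    (p q k l r s : Fin n) :
    dotTensor g U T x p q k l r s = -u₂ * tachibana g T x p q k l r s := by
  -- Contraction with g⁻¹ reproduces each block and annihilates mixed pairs: E g⁻¹ E = E, F g⁻¹ F =
  -- F, E g⁻¹ F = 0.
  have contr : ∀ (α₁ α₂ α₃ α₄ β₁ β₂ β₃ β₄ : ℝ) (u v : Fin n),
      ∑ a, ∑ b, (g x)⁻¹ a b * ((α₁ * E r b + α₂ * E s b + α₃ * F r b + α₄ * F s b) *
        (β₁ * E a u + β₂ * E a v + β₃ * F a u + β₄ * F a v)) =
      α₁ * (β₁ * E r u + β₂ * E r v) + α₂ * (β₁ * E s u + β₂ * E s v)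
        + α₃ * (β₃ * F r u + β₄ * F r v) + α₄ * (β₃ * F s u + β₄ * F s v) := by
    intro α₁ α₂ α₃ α₄ β₁ β₂ β₃ β₄ u v
    have expand : ∀ a b, (g x)⁻¹ a b * ((α₁ * E r b + α₂ * E s b + α₃ * F r b + α₄ * F s b) *
        (β₁ * E a u + β₂ * E a v + β₃ * F a u + β₄ * F a v)) =
        α₁ * β₁ * ((g x)⁻¹ a b * (E r b * E a u)) + α₁ * β₂ * ((g x)⁻¹ a b * (E r b * E a v))
        + α₁ * β₃ * ((g x)⁻¹ a b * (E r b * F a u)) + α₁ * β₄ * ((g x)⁻¹ a b * (E r b * F a v))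
        + α₂ * β₁ * ((g x)⁻¹ a b * (E s b * E a u)) + α₂ * β₂ * ((g x)⁻¹ a b * (E s b * E a v))
        + α₂ * β₃ * ((g x)⁻¹ a b * (E s b * F a u)) + α₂ * β₄ * ((g x)⁻¹ a b * (E s b * F a v))
        + α₃ * β₁ * ((g x)⁻¹ a b * (F r b * E a u)) + α₃ * β₂ * ((g x)⁻¹ a b * (F r b * E a v))
        + α₃ * β₃ * ((g x)⁻¹ a b * (F r b * F a u)) + α₃ * β₄ * ((g x)⁻¹ a b * (F r b * F a v))
        + α₄ * β₁ * ((g x)⁻¹ a b * (F s b * E a u)) + α₄ * β₂ * ((g x)⁻¹ a b * (F s b * E a v))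
        + α₄ * β₃ * ((g x)⁻¹ a b * (F s b * F a u))
        + α₄ * β₄ * ((g x)⁻¹ a b * (F s b * F a v)) := fun a b => by ring
    simp only [expand, Finset.sum_add_distrib, ← Finset.mul_sum, hEE, hEF, hFE, hFF]
    ring
  -- One of the four terms of U · T. With three indices of T fixed, the remaining one enters only
  -- through E and F paired with two of the fixed indices u, v.
  have slot : ∀ (c u v : Fin n) (γ₁ γ₂ δ₁ δ₂ : ℝ) (t : Fin n → ℝ),
      (∀ a, t a = γ₁ * E a u + γ₂ * E a v + δ₁ * F a u + δ₂ * F a v) →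
      ∑ a, ∑ b, (g x)⁻¹ a b * (U x r s c b * t a) =
        (u₁ * E s c + u₂ * F s c) * (γ₁ * E r u + γ₂ * E r v)
        - (u₁ * E r c + u₂ * F r c) * (γ₁ * E s u + γ₂ * E s v)
        + (u₂ * E s c + u₃ * F s c) * (δ₁ * F r u + δ₂ * F r v)
        - (u₂ * E r c + u₃ * F r c) * (δ₁ * F s u + δ₂ * F s v) := by
    intro c u v γ₁ γ₂ δ₁ δ₂ t ht
    have h1 := contr (u₁ * E s c + u₂ * F s c) (-(u₁ * E r c + u₂ * F r c))
      (u₂ * E s c + u₃ * F s c) (-(u₂ * E r c + u₃ * F r c)) γ₁ γ₂ δ₁ δ₂ u v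
    refine Eq.trans (Finset.sum_congr rfl fun a _ => Finset.sum_congr rfl fun b _ => ?_)
      (h1.trans (by ring))
    rw [ht, hU]
    simp only [halfWedge]
    ring
  have s₁ := slot p l k (k₁ * E q k) (-(k₁ * E q l)) (k₂ * F q k) (-(k₂ * F q l))
    (fun a => T x a q k l) (fun a => by rw [hT]; simp only [halfWedge]; ring)
  have s₂ := slot q k l (k₁ * E p l) (-(k₁ * E p k)) (k₂ * F p l) (-(k₂ * F p k))
    (fun a => T x p a k l) (fun a => by rw [hT]; simp only [halfWedge]; ring)
  have s₃ := slot k q p (k₁ * E p l) (-(k₁ * E q l)) (k₂ * F p l) (-(k₂ * F q l))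
    (fun a => T x p q a l) (fun a => by
      rw [hT, hE a q, hE a p, hF a q, hF a p]; simp only [halfWedge]; ring)
  have s₄ := slot l p q (k₁ * E q k) (-(k₁ * E p k)) (k₂ * F q k) (-(k₂ * F p k))
    (fun a => T x p q k a) (fun a => by
      rw [hT, hE a q, hE a p, hF a q, hF a p]; simp only [halfWedge]; ring)
  simp only [dotTensor, mul_add, Finset.sum_add_distrib]
  rw [s₁, s₂, s₃, s₄]
  simp only [tachibana, hT, hg, Matrix.add_apply, halfWedge, hE r p, hE s p, hE r q, hE s q, hE r k,
    hE s k, hE r l, hE s l, hF r p, hF s p, hF r q, hF s q, hF r k, hF s k, hF r l, hF s l]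
  ring

/-! ### Curvature tensors and their products in terms of the two blocks -/

namespace IsWarpedData

variable {r₀ L₀ : ℝ} {I J : Set ℝ} {ξ h : ℝ → ℝ} {x : Pt 4}

theorem ricci_cntm (H : IsWarpedData r₀ L₀ I J ξ h) (hx : x ∈ chartDomain I J) (q r : Fin 4) :
    ricci (cntm r₀ L₀ ξ h) x q r = warpCurv (r₀ ^ 2 / L₀) ξ (x 1) * firstBlock r₀ L₀ ξ (x 1) q r
      + warpCurv (r₀ ^ 2) h (x 2) * secondBlock r₀ h (x 2) q r := by
  simp only [ricci, Matrix.of_apply, H.riemannUp_cntm hx, halfWedge, Fin.sum_univ_four]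
  fin_cases q <;> fin_cases r <;> simp [firstBlock, secondBlock]

theorem riemann_cntm (H : IsWarpedData r₀ L₀ I J ξ h) (hx : x ∈ chartDomain I J)
    (p q r s : Fin 4) : riemann (cntm r₀ L₀ ξ h) x p q r s =
      warpCurv (r₀ ^ 2 / L₀) ξ (x 1)
        * halfWedge (firstBlock r₀ L₀ ξ (x 1)) (firstBlock r₀ L₀ ξ (x 1)) p q r s
      + warpCurv (r₀ ^ 2) h (x 2)
        * halfWedge (secondBlock r₀ h (x 2)) (secondBlock r₀ h (x 2)) p q r s := by
  have e1 : ∀ p, ∑ t, cntm r₀ L₀ ξ h x s t * (Matrix.diagonal ![1, 1, 0, 0] : Matrix _ _ ℝ) p t =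
      firstBlock r₀ L₀ ξ (x 1) p s := by
    intro p
    fin_cases s <;> fin_cases p <;> simp [Fin.sum_univ_four, cntm, firstBlock]
  have e2 : ∀ p, ∑ t, cntm r₀ L₀ ξ h x s t * (Matrix.diagonal ![0, 0, 1, 1] : Matrix _ _ ℝ) p t =
      secondBlock r₀ h (x 2) p s := by
    intro p
    fin_cases s <;> fin_cases p <;> simp [Fin.sum_univ_four, cntm, secondBlock]
  simp only [riemann, H.riemannUp_cntm hx, halfWedge, ← e1, ← e2, Fin.sum_univ_four]
  ring

theorem ricciOp_cntm (H : IsWarpedData r₀ L₀ I J ξ h) (hx : x ∈ chartDomain I J) :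
    ricciOp (cntm r₀ L₀ ξ h) x = Matrix.diagonal ![warpCurv (r₀ ^ 2 / L₀) ξ (x 1),
      warpCurv (r₀ ^ 2 / L₀) ξ (x 1), warpCurv (r₀ ^ 2) h (x 2), warpCurv (r₀ ^ 2) h (x 2)] := by
  have h1 := H.r₀_ne
  have h2 := H.L₀_ne
  have h3 := H.left_ne _ hx.1
  have h4 := H.right_ne _ hx.2
  ext i j
  rw [ricciOp, H.inv_cntm hx, Matrix.diagonal_mul, H.ricci_cntm hx]
  fin_cases i <;> fin_cases j <;> simp [firstBlock, secondBlock] <;> field_simp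

theorem scalarCurv_cntm (H : IsWarpedData r₀ L₀ I J ξ h) (hx : x ∈ chartDomain I J) :
    scalarCurv (cntm r₀ L₀ ξ h) x =
      2 * (warpCurv (r₀ ^ 2 / L₀) ξ (x 1) + warpCurv (r₀ ^ 2) h (x 2)) := by
  rw [scalarCurv, H.ricciOp_cntm hx, Matrix.trace_diagonal]
  simp [Fin.sum_univ_four]
  ring

/-- All coefficients are multiples of κ₁ + κ₂, the only scalar in C. They are written as explicit
combinations of κ₁ and κ₂ to match `covDeriv_cntm`; E, F, κ₁, κ₂ are variables so that `ring` sees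
them as atoms. -/
theorem conformal_cntm (H : IsWarpedData r₀ L₀ I J ξ h) (hx : x ∈ chartDomain I J)
    (p q r s : Fin 4) {E F : Matrix (Fin 4) (Fin 4) ℝ} {κ₁ κ₂ : ℝ}
    (hE : E = firstBlock r₀ L₀ ξ (x 1)) (hF : F = secondBlock r₀ h (x 2))
    (hκ₁ : κ₁ = warpCurv (r₀ ^ 2 / L₀) ξ (x 1)) (hκ₂ : κ₂ = warpCurv (r₀ ^ 2) h (x 2)) :
    conformal (cntm r₀ L₀ ξ h) x p q r s =
      (1 / 3 * κ₁ + 1 / 3 * κ₂) * halfWedge E E p q r s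
      + (-1 / 6 * κ₁ + -1 / 6 * κ₂) * halfWedge E F p q r s
      + (-1 / 6 * κ₁ + -1 / 6 * κ₂) * halfWedge F E p q r s
      + (1 / 3 * κ₁ + 1 / 3 * κ₂) * halfWedge F F p q r s := by
  simp only [conformal, H.riemann_cntm hx, H.ricci_cntm hx, H.scalarCurv_cntm hx, cntm_eq,
    ← hE, ← hF, ← hκ₁, ← hκ₂, Matrix.add_apply, halfWedge]
  norm_num
  ring

/-- P lacks the pair symmetry of R, so EF and FE carry different coefficients. -/
theorem projective_cntm (H : IsWarpedData r₀ L₀ I J ξ h) (hx : x ∈ chartDomain I J)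
    (p q r s : Fin 4) {E F : Matrix (Fin 4) (Fin 4) ℝ} {κ₁ κ₂ : ℝ}
    (hE : E = firstBlock r₀ L₀ ξ (x 1)) (hF : F = secondBlock r₀ h (x 2))
    (hκ₁ : κ₁ = warpCurv (r₀ ^ 2 / L₀) ξ (x 1)) (hκ₂ : κ₂ = warpCurv (r₀ ^ 2) h (x 2)) :
    projective (cntm r₀ L₀ ξ h) x p q r s =
      (2 / 3 * κ₁ + 0 * κ₂) * halfWedge E E p q r s
      + (0 * κ₁ + -1 / 3 * κ₂) * halfWedge E F p q r s
      + (-1 / 3 * κ₁ + 0 * κ₂) * halfWedge F E p q r s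
      + (0 * κ₁ + 2 / 3 * κ₂) * halfWedge F F p q r s := by
  simp only [projective, H.riemann_cntm hx, H.ricci_cntm hx, cntm_eq,
    ← hE, ← hF, ← hκ₁, ← hκ₂, Matrix.add_apply, halfWedge]
  norm_num
  ring

theorem concircular_cntm (H : IsWarpedData r₀ L₀ I J ξ h) (hx : x ∈ chartDomain I J)
    (p q r s : Fin 4) {E F : Matrix (Fin 4) (Fin 4) ℝ} {κ₁ κ₂ : ℝ}
    (hE : E = firstBlock r₀ L₀ ξ (x 1)) (hF : F = secondBlock r₀ h (x 2))
    (hκ₁ : κ₁ = warpCurv (r₀ ^ 2 / L₀) ξ (x 1)) (hκ₂ : κ₂ = warpCurv (r₀ ^ 2) h (x 2)) :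
    concircular (cntm r₀ L₀ ξ h) x p q r s =
      (5 / 6 * κ₁ + -1 / 6 * κ₂) * halfWedge E E p q r s
      + (-1 / 6 * κ₁ + -1 / 6 * κ₂) * halfWedge E F p q r s
      + (-1 / 6 * κ₁ + -1 / 6 * κ₂) * halfWedge F E p q r s
      + (-1 / 6 * κ₁ + 5 / 6 * κ₂) * halfWedge F F p q r s := by
  simp only [concircular, H.riemann_cntm hx, H.scalarCurv_cntm hx, cntm_eq,
    ← hE, ← hF, ← hκ₁, ← hκ₂, Matrix.add_apply, halfWedge]
  norm_num
  ring

theorem kulkarniNomizu_metric_ricci (H : IsWarpedData r₀ L₀ I J ξ h) (hx : x ∈ chartDomain I J)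
    (p q r s : Fin 4) {E F : Matrix (Fin 4) (Fin 4) ℝ} {κ₁ κ₂ : ℝ}
    (hE : E = firstBlock r₀ L₀ ξ (x 1)) (hF : F = secondBlock r₀ h (x 2))
    (hκ₁ : κ₁ = warpCurv (r₀ ^ 2 / L₀) ξ (x 1)) (hκ₂ : κ₂ = warpCurv (r₀ ^ 2) h (x 2)) :
    kulkarniNomizu (cntm r₀ L₀ ξ h) (ricci (cntm r₀ L₀ ξ h)) x p q r s =
      2 * κ₁ * halfWedge E E p q r s + (κ₁ + κ₂) * halfWedge E F p q r s
      + (κ₁ + κ₂) * halfWedge F E p q r s + 2 * κ₂ * halfWedge F F p q r s := by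
  simp only [kulkarniNomizu, H.ricci_cntm hx, cntm_eq, ← hE, ← hF, ← hκ₁, ← hκ₂, Matrix.add_apply,
    halfWedge]
  ring

theorem kulkarniNomizu_ricci_ricci (H : IsWarpedData r₀ L₀ I J ξ h) (hx : x ∈ chartDomain I J)
    (p q r s : Fin 4) {E F : Matrix (Fin 4) (Fin 4) ℝ} {κ₁ κ₂ : ℝ}
    (hE : E = firstBlock r₀ L₀ ξ (x 1)) (hF : F = secondBlock r₀ h (x 2))
    (hκ₁ : κ₁ = warpCurv (r₀ ^ 2 / L₀) ξ (x 1)) (hκ₂ : κ₂ = warpCurv (r₀ ^ 2) h (x 2)) :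
    kulkarniNomizu (ricci (cntm r₀ L₀ ξ h)) (ricci (cntm r₀ L₀ ξ h)) x p q r s =
      2 * κ₁ ^ 2 * halfWedge E E p q r s + 2 * (κ₁ * κ₂) * halfWedge E F p q r s
      + 2 * (κ₁ * κ₂) * halfWedge F E p q r s + 2 * κ₂ ^ 2 * halfWedge F F p q r s := by
  simp only [kulkarniNomizu, H.ricci_cntm hx, ← hE, ← hF, ← hκ₁, ← hκ₂, halfWedge]
  ring

theorem kulkarniNomizu_metric_metric (p q r s : Fin 4) {E F : Matrix (Fin 4) (Fin 4) ℝ}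
    (hE : E = firstBlock r₀ L₀ ξ (x 1)) (hF : F = secondBlock r₀ h (x 2)) :
    kulkarniNomizu (cntm r₀ L₀ ξ h) (cntm r₀ L₀ ξ h) x p q r s =
      2 * halfWedge E E p q r s + 2 * halfWedge E F p q r s
      + 2 * halfWedge F E p q r s + 2 * halfWedge F F p q r s := by
  simp only [kulkarniNomizu, cntm_eq, ← hE, ← hF, Matrix.add_apply, halfWedge]
  ring

theorem dotTensor_cntm (H : IsWarpedData r₀ L₀ I J ξ h) (hx : x ∈ chartDomain I J)
    {U : Tensor4 4} {u₁ u₂ u₃ : ℝ} {E F : Matrix (Fin 4) (Fin 4) ℝ}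
    (hE : E = firstBlock r₀ L₀ ξ (x 1)) (hF : F = secondBlock r₀ h (x 2))
    (hU : ∀ p q r s, U x p q r s = u₁ * halfWedge E E p q r s
      + u₂ * (halfWedge E F p q r s + halfWedge F E p q r s) + u₃ * halfWedge F F p q r s)
    (p q k l r s : Fin 4) :
    dotTensor (cntm r₀ L₀ ξ h) U (riemann (cntm r₀ L₀ ξ h)) x p q k l r s =
      -u₂ * tachibana (cntm r₀ L₀ ξ h) (riemann (cntm r₀ L₀ ξ h)) x p q k l r s := by
  have h1 := H.r₀_ne
  have h2 := H.L₀_ne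
  have h3 := H.left_ne _ hx.1
  have h4 := H.right_ne _ hx.2
  subst hE hF
  refine dotTensor_of_blocks (cntm_eq r₀ L₀ ξ h x) (firstBlock_symm _ _ _ _)
    (secondBlock_symm _ _ _) ?_ ?_ ?_ ?_ hU (H.riemann_cntm hx) p q k l r s
  all_goals
    intro c d
    simp only [H.inv_cntm hx, Matrix.diagonal_apply, ite_mul, zero_mul, Finset.sum_ite_eq,
      Finset.mem_univ, if_true, Fin.sum_univ_four, firstBlock, secondBlock]
    fin_cases c <;> fin_cases d <;> simp <;> try field_simp

/-- The Ricci operator multiplies E by κ₁ and F by κ₂ in the contracted slot. Each product then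
contributes a multiple of X_{pc}Y_{qs} - X_{qc}Y_{ps}, whose cyclic sum over c, p, q vanishes
because X is symmetric. -/
theorem isRicciCompatible_of_halfWedge (H : IsWarpedData r₀ L₀ I J ξ h) {B : Tensor4 4}
    (hB : ∀ x ∈ chartDomain I J, ∃ b₁ b₂ b₃ : ℝ, ∀ p q r s, B x p q r s =
      b₁ * halfWedge (firstBlock r₀ L₀ ξ (x 1)) (firstBlock r₀ L₀ ξ (x 1)) p q r s
      + b₂ * warpCurv (r₀ ^ 2) h (x 2)
        * halfWedge (firstBlock r₀ L₀ ξ (x 1)) (secondBlock r₀ h (x 2)) p q r s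
      + b₂ * warpCurv (r₀ ^ 2 / L₀) ξ (x 1)
        * halfWedge (secondBlock r₀ h (x 2)) (firstBlock r₀ L₀ ξ (x 1)) p q r s
      + b₃ * halfWedge (secondBlock r₀ h (x 2)) (secondBlock r₀ h (x 2)) p q r s) :
    IsRicciCompatibleOn (cntm r₀ L₀ ξ h) B (chartDomain I J) := by
  intro x hx p q r s
  obtain ⟨b₁, b₂, b₃, hB⟩ := hB x hx
  have hE := firstBlock_symm r₀ L₀ ξ (x 1)
  have hF := secondBlock_symm r₀ h (x 2)
  have e1 : ∀ c d, ∑ t, ricciOp (cntm r₀ L₀ ξ h) x t c * firstBlock r₀ L₀ ξ (x 1) d t =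
      warpCurv (r₀ ^ 2 / L₀) ξ (x 1) * firstBlock r₀ L₀ ξ (x 1) d c := by
    intro c d
    rw [H.ricciOp_cntm hx]
    fin_cases c <;> fin_cases d <;> simp [Fin.sum_univ_four, firstBlock]
  have e2 : ∀ c d, ∑ t, ricciOp (cntm r₀ L₀ ξ h) x t c * secondBlock r₀ h (x 2) d t =
      warpCurv (r₀ ^ 2) h (x 2) * secondBlock r₀ h (x 2) d c := by
    intro c d
    rw [H.ricciOp_cntm hx]
    fin_cases c <;> fin_cases d <;> simp [Fin.sum_univ_four, secondBlock]
  generalize warpCurv (r₀ ^ 2 / L₀) ξ (x 1) = κ₁ at *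
  generalize warpCurv (r₀ ^ 2) h (x 2) = κ₂ at *
  generalize firstBlock r₀ L₀ ξ (x 1) = E at *
  generalize secondBlock r₀ h (x 2) = F at *
  have term : ∀ c p q, ∑ t, ricciOp (cntm r₀ L₀ ξ h) x t c * B x p q s t =
      b₁ * (κ₁ * E p c * E q s - κ₁ * E q c * E p s)
      + b₂ * κ₂ * (κ₁ * E p c * F q s - κ₁ * E q c * F p s)
      + b₂ * κ₁ * (κ₂ * F p c * E q s - κ₂ * F q c * E p s)
      + b₃ * (κ₂ * F p c * F q s - κ₂ * F q c * F p s) := by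
    intro c p q
    simp only [← e1, ← e2, hB, halfWedge, Fin.sum_univ_four]
    ring
  simp only [Finset.sum_add_distrib, term, hE q p, hE r p, hE r q, hF q p, hF r p, hF r q]
  ring
end IsWarpedData

/-! ### Smoothness of the curvature functions and of their logarithmic derivatives -/

theorem contDiffOn_comp_coord {n : ℕ} {f : ℝ → ℝ} {U : Set ℝ} {V : Set (Pt n)} {j : Fin n}
    (hf : ContDiffOn ℝ ∞ f U) (hV : ∀ x ∈ V, x j ∈ U) :
    ContDiffOn ℝ ∞ (fun x : Pt n => f (x j)) V :=
  hf.comp (contDiff_apply ℝ ℝ j).contDiffOn hV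

theorem contDiffOn_warpCurv {c : ℝ} {f : ℝ → ℝ} {U : Set ℝ} (hc : c ≠ 0) (hU : IsOpen U)
    (hf : ContDiffOn ℝ ∞ f U) (hf0 : ∀ s ∈ U, f s ≠ 0) : ContDiffOn ℝ ∞ (warpCurv c f) U :=
  (contDiffOn_deriv hU (contDiffOn_deriv hU hf)).div (contDiffOn_const.mul hf)
    fun s hs => mul_ne_zero hc (hf0 s hs)

theorem NonzeroOrLocallyZeroAt.warpCurv {c : ℝ} {f : ℝ → ℝ} {s : ℝ} (hc : c ≠ 0) (hf0 : f s ≠ 0)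
    (hs : NonzeroOrLocallyZeroAt (deriv (deriv f)) s) :
    NonzeroOrLocallyZeroAt (warpCurv c f) s := by
  refine hs.imp (fun h => div_ne_zero h (mul_ne_zero hc hf0)) fun h => ?_
  filter_upwards [h] with t ht
  simp [SemiRiem.warpCurv, ht]

/-- Where f vanishes locally, the convention y / 0 = 0 makes the quotient locally zero. At other
zeros of f it could be singular, which is what V excludes. -/
theorem NonzeroOrLocallyZeroAt.contDiffAt_logDeriv {f : ℝ → ℝ} {U : Set ℝ} {s : ℝ} (hU : IsOpen U)
    (hf : ContDiffOn ℝ ∞ f U) (hsU : s ∈ U) (hs : NonzeroOrLocallyZeroAt f s) :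
    ContDiffAt ℝ ∞ (fun t => deriv f t / f t) s := by
  rcases hs with hs | hs
  · exact ((contDiffOn_deriv hU hf).contDiffAt (hU.mem_nhds hsU)).div
      (hf.contDiffAt (hU.mem_nhds hsU)) hs
  · refine (contDiffAt_const (c := (0 : ℝ))).congr_of_eventuallyEq ?_
    filter_upwards [hs] with t ht
    simp [ht]

theorem NonzeroOrLocallyZeroAt.logDeriv_mul {f : ℝ → ℝ} {s : ℝ} (hs : NonzeroOrLocallyZeroAt f s) :
    deriv f s / f s * f s = deriv f s := by
  rcases hs with hs | hs
  · exact div_mul_cancel₀ _ hs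
  · have h1 : f =ᶠ[nhds s] fun _ => (0 : ℝ) := hs
    simp [h1.deriv_eq]

/-- Components of the one-form `f(x_j) dx_j`. -/
def coordForm {n : ℕ} (j : Fin n) (f : ℝ → ℝ) : CovectorField n :=
  fun x a => if a = j then f (x j) else 0

theorem contDiffOn_coordForm {n : ℕ} {f : ℝ → ℝ} {V : Set (Pt n)} {j : Fin n}
    (hf : ContDiffOn ℝ ∞ (fun x : Pt n => f (x j)) V) (a : Fin n) :
    ContDiffOn ℝ ∞ (fun x => coordForm j f x a) V := by
  by_cases h : a = j
  · simpa [coordForm, h] using hf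
  · simpa [coordForm, h] using contDiffOn_const

/-! ### The differentials of κ₁, κ₂ and covariant derivatives -/

namespace IsWarpedData

variable {r₀ L₀ : ℝ} {I J : Set ℝ} {ξ h : ℝ → ℝ} {x : Pt 4}

theorem left_scale_ne (H : IsWarpedData r₀ L₀ I J ξ h) : r₀ ^ 2 / L₀ ≠ 0 :=
  div_ne_zero (pow_ne_zero 2 H.r₀_ne) H.L₀_ne

theorem contDiffOn_left_curv (H : IsWarpedData r₀ L₀ I J ξ h) :
    ContDiffOn ℝ ∞ (warpCurv (r₀ ^ 2 / L₀) ξ) I :=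
  contDiffOn_warpCurv H.left_scale_ne H.isOpen_left H.contDiffOn_left H.left_ne

theorem contDiffOn_right_curv (H : IsWarpedData r₀ L₀ I J ξ h) :
    ContDiffOn ℝ ∞ (warpCurv (r₀ ^ 2) h) J :=
  contDiffOn_warpCurv (pow_ne_zero 2 H.r₀_ne) H.isOpen_right H.contDiffOn_right H.right_ne

theorem contDiffOn_left_curv_coord (H : IsWarpedData r₀ L₀ I J ξ h) :
    ContDiffOn ℝ ∞ (fun x : Pt 4 => warpCurv (r₀ ^ 2 / L₀) ξ (x 1)) (chartDomain I J) :=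
  contDiffOn_comp_coord H.contDiffOn_left_curv fun _ hx => hx.1

theorem contDiffOn_right_curv_coord (H : IsWarpedData r₀ L₀ I J ξ h) :
    ContDiffOn ℝ ∞ (fun x : Pt 4 => warpCurv (r₀ ^ 2) h (x 2)) (chartDomain I J) :=
  contDiffOn_comp_coord H.contDiffOn_right_curv fun _ hx => hx.2

theorem contDiffOn_left_form (H : IsWarpedData r₀ L₀ I J ξ h) (a : Fin 4) :
    ContDiffOn ℝ ∞ (fun x => coordForm 1 (deriv (warpCurv (r₀ ^ 2 / L₀) ξ)) x a)
      (chartDomain I J) :=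
  contDiffOn_coordForm (contDiffOn_comp_coord
    (contDiffOn_deriv H.isOpen_left H.contDiffOn_left_curv) fun _ hx => hx.1) a

theorem contDiffOn_right_form (H : IsWarpedData r₀ L₀ I J ξ h) (a : Fin 4) :
    ContDiffOn ℝ ∞ (fun x => coordForm 2 (deriv (warpCurv (r₀ ^ 2) h)) x a)
      (chartDomain I J) :=
  contDiffOn_coordForm (contDiffOn_comp_coord
    (contDiffOn_deriv H.isOpen_right H.contDiffOn_right_curv) fun _ hx => hx.2) a

/-- Identifies U_S as a place where κ₁ - κ₂ may be a denominator; `curv_add_ne` does the same for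
U_C and κ₁ + κ₂. -/
theorem curv_sub_ne (H : IsWarpedData r₀ L₀ I J ξ h) (hx : x ∈ chartDomain I J)
    (hd : einsteinDefect L₀ ξ h x ≠ 0) :
    warpCurv (r₀ ^ 2 / L₀) ξ (x 1) - warpCurv (r₀ ^ 2) h (x 2) ≠ 0 := by
  have h1 := H.r₀_ne
  have h2 := H.L₀_ne
  have h3 := H.left_ne _ hx.1
  have h4 := H.right_ne _ hx.2
  have : warpCurv (r₀ ^ 2 / L₀) ξ (x 1) - warpCurv (r₀ ^ 2) h (x 2) =
      einsteinDefect L₀ ξ h x / (r₀ ^ 2 * ξ (x 1) * h (x 2)) := by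
    simp only [warpCurv, einsteinDefect]
    field_simp
  rw [this]
  positivity

theorem curv_add_ne (H : IsWarpedData r₀ L₀ I J ξ h) (hx : x ∈ chartDomain I J)
    (hd : weylFactor L₀ ξ h x ≠ 0) :
    warpCurv (r₀ ^ 2 / L₀) ξ (x 1) + warpCurv (r₀ ^ 2) h (x 2) ≠ 0 := by
  have h1 := H.r₀_ne
  have h2 := H.L₀_ne
  have h3 := H.left_ne _ hx.1
  have h4 := H.right_ne _ hx.2
  have : warpCurv (r₀ ^ 2 / L₀) ξ (x 1) + warpCurv (r₀ ^ 2) h (x 2) =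
      weylFactor L₀ ξ h x / (r₀ ^ 2 * ξ (x 1) * h (x 2)) := by
    simp only [warpCurv, weylFactor]
    field_simp
  rw [this]
  positivity

theorem pderiv_curv_combination (H : IsWarpedData r₀ L₀ I J ξ h) (hx : x ∈ chartDomain I J)
    (α β : ℝ) (a : Fin 4) :
    DifferentiableAt ℝ (fun y : Pt 4 =>
      α * warpCurv (r₀ ^ 2 / L₀) ξ (y 1) + β * warpCurv (r₀ ^ 2) h (y 2)) x ∧
    pderiv a (fun y => α * warpCurv (r₀ ^ 2 / L₀) ξ (y 1) + β * warpCurv (r₀ ^ 2) h (y 2)) x =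
      α * coordForm 1 (deriv (warpCurv (r₀ ^ 2 / L₀) ξ)) x a
        + β * coordForm 2 (deriv (warpCurv (r₀ ^ 2) h)) x a := by
  have h1 := (hasDerivAt_of_contDiffOn H.isOpen_left H.contDiffOn_left_curv hx.1).const_mul α
  have h2 := (hasDerivAt_of_contDiffOn H.isOpen_right H.contDiffOn_right_curv hx.2).const_mul β
  have d1 := differentiableAt_comp_coord h1.differentiableAt
  have d2 := differentiableAt_comp_coord h2.differentiableAt
  refine ⟨d1.fun_add d2, ?_⟩
  rw [pderiv_add a d1 d2, pderiv_comp_coord h1, pderiv_comp_coord h2]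
  simp [coordForm]

theorem covDeriv_cntm (H : IsWarpedData r₀ L₀ I J ξ h) (hx : x ∈ chartDomain I J)
    {E F : Matrix (Fin 4) (Fin 4) ℝ}
    (hE : E = firstBlock r₀ L₀ ξ (x 1)) (hF : F = secondBlock r₀ h (x 2))
    {T : Tensor4 4} {α₁ β₁ α₂ β₂ α₃ β₃ α₄ β₄ : ℝ}
    (hT : ∀ y ∈ chartDomain I J, ∀ p q r s, T y p q r s =
      (α₁ * warpCurv (r₀ ^ 2 / L₀) ξ (y 1) + β₁ * warpCurv (r₀ ^ 2) h (y 2))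
        * halfWedge (firstBlock r₀ L₀ ξ (y 1)) (firstBlock r₀ L₀ ξ (y 1)) p q r s
      + (α₂ * warpCurv (r₀ ^ 2 / L₀) ξ (y 1) + β₂ * warpCurv (r₀ ^ 2) h (y 2))
        * halfWedge (firstBlock r₀ L₀ ξ (y 1)) (secondBlock r₀ h (y 2)) p q r s
      + (α₃ * warpCurv (r₀ ^ 2 / L₀) ξ (y 1) + β₃ * warpCurv (r₀ ^ 2) h (y 2))
        * halfWedge (secondBlock r₀ h (y 2)) (firstBlock r₀ L₀ ξ (y 1)) p q r s
      + (α₄ * warpCurv (r₀ ^ 2 / L₀) ξ (y 1) + β₄ * warpCurv (r₀ ^ 2) h (y 2))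
        * halfWedge (secondBlock r₀ h (y 2)) (secondBlock r₀ h (y 2)) p q r s)
    (a p q r s : Fin 4) {d₁ d₂ : ℝ}
    (hd₁ : d₁ = coordForm 1 (deriv (warpCurv (r₀ ^ 2 / L₀) ξ)) x a)
    (hd₂ : d₂ = coordForm 2 (deriv (warpCurv (r₀ ^ 2) h)) x a) :
    covDeriv (cntm r₀ L₀ ξ h) T x a p q r s =
      (α₁ * d₁ + β₁ * d₂) * halfWedge E E p q r s + (α₂ * d₁ + β₂ * d₂) * halfWedge E F p q r s
      + (α₃ * d₁ + β₃ * d₂) * halfWedge F E p q r s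
      + (α₄ * d₁ + β₄ * d₂) * halfWedge F F p q r s := by
  subst hE hF hd₁ hd₂
  have D := fun α β => H.pderiv_curv_combination hx α β a
  rw [covDeriv_of_eventuallyEq (H.isParallelAt_firstBlock hx) (H.isParallelAt_secondBlock hx)
    (D α₁ β₁).1 (D α₂ β₂).1 (D α₃ β₃).1 (D α₄ β₄).1
    (Filter.eventually_of_mem (H.isOpen_chartDomain.mem_nhds hx) hT),
    (D α₁ β₁).2, (D α₂ β₂).2, (D α₃ β₃).2, (D α₄ β₄).2]

/-! ### The curvature conditions -/

theorem isSemisymmetricOn (H : IsWarpedData r₀ L₀ I J ξ h) :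
    IsSemisymmetricOn (cntm r₀ L₀ ξ h) (riemann (cntm r₀ L₀ ξ h)) (riemann (cntm r₀ L₀ ξ h))
      (chartDomain I J) := by
  intro x hx p q k l r s
  rw [H.dotTensor_cntm hx (u₁ := warpCurv (r₀ ^ 2 / L₀) ξ (x 1)) (u₂ := 0)
    (u₃ := warpCurv (r₀ ^ 2) h (x 2)) rfl rfl (fun p q r s => by rw [H.riemann_cntm hx]; ring)]
  ring

theorem isPseudosymmetricOn (H : IsWarpedData r₀ L₀ I J ξ h) :
    IsPseudosymmetricOn (cntm r₀ L₀ ξ h) (conformal (cntm r₀ L₀ ξ h)) (cntm r₀ L₀ ξ h)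
      (riemann (cntm r₀ L₀ ξ h)) (chartDomain I J) := by
  refine ⟨fun x => (warpCurv (r₀ ^ 2 / L₀) ξ (x 1) + warpCurv (r₀ ^ 2) h (x 2)) / 6,
    (H.contDiffOn_left_curv_coord.add H.contDiffOn_right_curv_coord).div_const 6,
    fun x hx p q k l r s => ?_⟩
  rw [H.dotTensor_cntm hx
    (u₂ := -(warpCurv (r₀ ^ 2 / L₀) ξ (x 1) + warpCurv (r₀ ^ 2) h (x 2)) / 6)
    (u₁ := (warpCurv (r₀ ^ 2 / L₀) ξ (x 1) + warpCurv (r₀ ^ 2) h (x 2)) / 3)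
    (u₃ := (warpCurv (r₀ ^ 2 / L₀) ξ (x 1) + warpCurv (r₀ ^ 2) h (x 2)) / 3) rfl rfl
    (fun p q r s => by rw [H.conformal_cntm hx p q r s rfl rfl rfl rfl]; ring)]
  ring

/-- With α = κ₂ one has S - αg = (κ₁ - κ₂)E, and E has rank 2. -/
theorem isQuasiEinsteinOn (H : IsWarpedData r₀ L₀ I J ξ h) :
    IsQuasiEinsteinOn 2 (cntm r₀ L₀ ξ h)
      {x ∈ chartDomain I J | einsteinDefect L₀ ξ h x ≠ 0} := by
  refine ⟨fun x => warpCurv (r₀ ^ 2) h (x 2),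
    H.contDiffOn_right_curv_coord.mono fun _ hx => hx.1, fun x ⟨hx, hd⟩ => ?_⟩
  have hne := H.curv_sub_ne hx hd
  have hA := H.left_scale_ne
  have hξ := H.left_ne _ hx.1
  have key : ricci (cntm r₀ L₀ ξ h) x - warpCurv (r₀ ^ 2) h (x 2) • cntm r₀ L₀ ξ h x =
      Matrix.diagonal ((warpCurv (r₀ ^ 2 / L₀) ξ (x 1) - warpCurv (r₀ ^ 2) h (x 2)) •
        ![-(r₀ ^ 2 / L₀ * ξ (x 1) ^ 2), r₀ ^ 2 / L₀, 0, 0]) := by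
    ext i j
    rw [Matrix.diagonal_smul, Matrix.sub_apply, H.ricci_cntm hx, cntm_eq, Matrix.smul_apply,
      Matrix.smul_apply, Matrix.add_apply, smul_eq_mul, smul_eq_mul]
    simp only [firstBlock]
    ring
  rw [key, Matrix.rank_diagonal, Fintype.card_subtype]
  have : (Finset.univ.filter fun i : Fin 4 =>
      ((warpCurv (r₀ ^ 2 / L₀) ξ (x 1) - warpCurv (r₀ ^ 2) h (x 2)) •
        ![-(r₀ ^ 2 / L₀ * ξ (x 1) ^ 2), r₀ ^ 2 / L₀, 0, 0]) i ≠ 0) = {0, 1} := by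
    ext i
    have h0 : r₀ ^ 2 / L₀ * ξ (x 1) ^ 2 ≠ 0 := mul_ne_zero hA (pow_ne_zero 2 hξ)
    simp only [Finset.mem_filter, Finset.mem_univ, true_and, Pi.smul_apply, smul_eq_mul,
      Finset.mem_insert, Finset.mem_singleton, mul_ne_zero_iff]
    fin_cases i
    · exact iff_of_true ⟨hne, neg_ne_zero.2 h0⟩ (Or.inl rfl)
    · exact iff_of_true ⟨hne, hA⟩ (Or.inr rfl)
    · exact iff_of_false (fun h => h.2 rfl) (by decide)
    · exact iff_of_false (fun h => h.2 rfl) (by decide)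
  rw [this]
  rfl

/-- S - κ₂g = D(-ξ²dt² + dr²) with D = (r₀²/L₀)(κ₁ - κ₂), and the form factors as the symmetric
product of η = dr - ξdt and dr + ξdt. Taking β = γ = 1 forces δ = (D(dr + ξdt) - η)/2. This is
nonzero even where D = 0, hence the result on all of M. -/
theorem isGenQuasiEinsteinOn (H : IsWarpedData r₀ L₀ I J ξ h) :
    IsGenQuasiEinsteinOn (cntm r₀ L₀ ξ h) (chartDomain I J) := by
  have hξ : ContDiffOn ℝ ∞ (fun x : Pt 4 => ξ (x 1)) (chartDomain I J) :=
    contDiffOn_comp_coord H.contDiffOn_left fun _ hx => hx.1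
  have hD : ContDiffOn ℝ ∞ (fun x : Pt 4 => r₀ ^ 2 / L₀ *
      (warpCurv (r₀ ^ 2 / L₀) ξ (x 1) - warpCurv (r₀ ^ 2) h (x 2))) (chartDomain I J) :=
    contDiffOn_const.mul (H.contDiffOn_left_curv_coord.sub H.contDiffOn_right_curv_coord)
  refine ⟨fun x => warpCurv (r₀ ^ 2) h (x 2), fun _ => 1, fun _ => 1,
    fun x => ![-ξ (x 1), 1, 0, 0],
    fun x => ![(r₀ ^ 2 / L₀ * (warpCurv (r₀ ^ 2 / L₀) ξ (x 1) - warpCurv (r₀ ^ 2) h (x 2)) + 1)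
      * ξ (x 1) / 2,
      (r₀ ^ 2 / L₀ * (warpCurv (r₀ ^ 2 / L₀) ξ (x 1) - warpCurv (r₀ ^ 2) h (x 2)) - 1) / 2, 0, 0],
    H.contDiffOn_right_curv_coord, contDiffOn_const, contDiffOn_const, ?_, ?_, fun x hx => ?_⟩
  · refine contDiffOn_pi.2 fun a => ?_
    fin_cases a
    · exact hξ.neg
    all_goals exact contDiffOn_const
  · refine contDiffOn_pi.2 fun a => ?_
    fin_cases a
    · exact ((hD.add contDiffOn_const).mul hξ).div_const 2
    · exact (hD.sub contDiffOn_const).div_const 2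
    all_goals exact contDiffOn_const
  · have hξx := H.left_ne _ hx.1
    refine ⟨one_ne_zero, one_ne_zero, fun h0 => one_ne_zero (congrFun h0 1), fun h0 => ?_,
      fun p q => ?_⟩
    · have h1 := congrFun h0 0
      have h2 := congrFun h0 1
      simp only [Matrix.cons_val_zero, Matrix.cons_val_one, Pi.zero_apply] at h1 h2
      have h3 : (2 : ℝ) * ξ (x 1) / 2 = 0 := by linear_combination h1 - ξ (x 1) * h2
      exact hξx (by linarith)
    · rw [H.ricci_cntm hx, cntm_eq, Matrix.add_apply]
      simp only [firstBlock, secondBlock]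
      fin_cases p <;> fin_cases q <;> simp <;> ring

/-- Since (S - κ₁g) ∧ (S - κ₂g) = -(κ₁ - κ₂)² E ∧ F, the mixed part EF + FE is a combination of S ∧
S, g ∧ S and g ∧ g. Subtracting (κ₁ + κ₂)/2 times it from ½ g ∧ S leaves R; `c3` is the resulting
μ₃. -/
theorem isRoterTypeOn (H : IsWarpedData r₀ L₀ I J ξ h) :
    IsRoterTypeOn (cntm r₀ L₀ ξ h) {x ∈ chartDomain I J | einsteinDefect L₀ ξ h x ≠ 0} := by
  have hsub : {x ∈ chartDomain I J | einsteinDefect L₀ ξ h x ≠ 0} ⊆ chartDomain I J :=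
    fun _ hx => hx.1
  have c1 := H.contDiffOn_left_curv_coord.mono hsub
  have c2 := H.contDiffOn_right_curv_coord.mono hsub
  have c3 := (c1.add c2).div (contDiffOn_const (c := (2 : ℝ)).mul ((c1.sub c2).pow 2))
    fun x hx => mul_ne_zero two_ne_zero (pow_ne_zero 2 (H.curv_sub_ne hx.1 hx.2))
  refine ⟨_, _, _,
    (c3.mul ((((c1.add c2).pow 2).div_const 2).sub (c1.mul c2))).sub ((c1.add c2).div_const 4),
    (contDiffOn_const (c := (1 / 2 : ℝ))).sub (c3.mul (c1.add c2)), c3,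
    fun x ⟨hx, hd⟩ p q r s => ?_⟩
  have hne := H.curv_sub_ne hx hd
  rw [H.riemann_cntm hx, kulkarniNomizu_metric_metric p q r s rfl rfl,
    H.kulkarniNomizu_metric_ricci hx p q r s rfl rfl rfl rfl,
    H.kulkarniNomizu_ricci_ricci hx p q r s rfl rfl rfl rfl]
  simp only [Pi.div_apply]
  field_simp
  ring

/-- T is R - (δ/2)(κ₁ + κ₂) g ∧ g, which treats R and W together. For δ = 0 the mixed coefficient
gives Θ = -Φκ₁κ₂. With uᵢ = dκᵢ/κᵢ the EE and FF coefficients then hold if Π ± 2Φ(κ₁ - κ₂) equals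
u₁, u₂ respectively. For other δ only Θ changes. -/
theorem isSpecialSuperGenRecurrentOn (H : IsWarpedData r₀ L₀ I J ξ h) {T : Tensor4 4} (δ : ℝ)
    (hT : ∀ y ∈ chartDomain I J, ∀ p q r s, T y p q r s =
      ((1 - δ) * warpCurv (r₀ ^ 2 / L₀) ξ (y 1) + -δ * warpCurv (r₀ ^ 2) h (y 2))
        * halfWedge (firstBlock r₀ L₀ ξ (y 1)) (firstBlock r₀ L₀ ξ (y 1)) p q r s
      + (-δ * warpCurv (r₀ ^ 2 / L₀) ξ (y 1) + -δ * warpCurv (r₀ ^ 2) h (y 2))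
        * halfWedge (firstBlock r₀ L₀ ξ (y 1)) (secondBlock r₀ h (y 2)) p q r s
      + (-δ * warpCurv (r₀ ^ 2 / L₀) ξ (y 1) + -δ * warpCurv (r₀ ^ 2) h (y 2))
        * halfWedge (secondBlock r₀ h (y 2)) (firstBlock r₀ L₀ ξ (y 1)) p q r s
      + (-δ * warpCurv (r₀ ^ 2 / L₀) ξ (y 1) + (1 - δ) * warpCurv (r₀ ^ 2) h (y 2))
        * halfWedge (secondBlock r₀ h (y 2)) (secondBlock r₀ h (y 2)) p q r s) :
    IsSpecialSuperGenRecurrentOn (cntm r₀ L₀ ξ h) T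
      {x ∈ {x ∈ chartDomain I J | einsteinDefect L₀ ξ h x ≠ 0} |
        NonzeroOrLocallyZeroAt (deriv (deriv ξ)) (x 1) ∧
        NonzeroOrLocallyZeroAt (deriv (deriv h)) (x 2)} := by
  set V := {x ∈ {x ∈ chartDomain I J | einsteinDefect L₀ ξ h x ≠ 0} |
    NonzeroOrLocallyZeroAt (deriv (deriv ξ)) (x 1) ∧
    NonzeroOrLocallyZeroAt (deriv (deriv h)) (x 2)} with hV
  have hsub : V ⊆ chartDomain I J := fun _ hx => hx.1.1
  have n1 : ∀ x ∈ V, NonzeroOrLocallyZeroAt (warpCurv (r₀ ^ 2 / L₀) ξ) (x 1) := fun x hx =>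
    hx.2.1.warpCurv H.left_scale_ne (H.left_ne _ hx.1.1.1)
  have n2 : ∀ x ∈ V, NonzeroOrLocallyZeroAt (warpCurv (r₀ ^ 2) h) (x 2) := fun x hx =>
    hx.2.2.warpCurv (pow_ne_zero 2 H.r₀_ne) (H.right_ne _ hx.1.1.2)
  set u₁ : CovectorField 4 := coordForm 1 fun s =>
    deriv (warpCurv (r₀ ^ 2 / L₀) ξ) s / warpCurv (r₀ ^ 2 / L₀) ξ s with hu₁
  set u₂ : CovectorField 4 := coordForm 2 fun s =>
    deriv (warpCurv (r₀ ^ 2) h) s / warpCurv (r₀ ^ 2) h s with hu₂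
  have s1 : ∀ a, ContDiffOn ℝ ∞ (fun x => u₁ x a) V := contDiffOn_coordForm fun x hx =>
    (((n1 x hx).contDiffAt_logDeriv H.isOpen_left H.contDiffOn_left_curv hx.1.1.1).comp x
      (contDiff_apply ℝ ℝ (1 : Fin 4)).contDiffAt).contDiffWithinAt
  have s2 : ∀ a, ContDiffOn ℝ ∞ (fun x => u₂ x a) V := contDiffOn_coordForm fun x hx =>
    (((n2 x hx).contDiffAt_logDeriv H.isOpen_right H.contDiffOn_right_curv hx.1.1.2).comp x
      (contDiff_apply ℝ ℝ (2 : Fin 4)).contDiffAt).contDiffWithinAt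
  have c1 := H.contDiffOn_left_curv_coord.mono hsub
  have c2 := H.contDiffOn_right_curv_coord.mono hsub
  have d1 := fun a => (H.contDiffOn_left_form a).mono hsub
  have d2 := fun a => (H.contDiffOn_right_form a).mono hsub
  have sϖ := fun a => ((s1 a).add (s2 a)).div_const 2
  have sΦ := fun a => ((s1 a).sub (s2 a)).div (contDiffOn_const (c := (4 : ℝ)).mul (c1.sub c2))
    fun x hx => mul_ne_zero four_ne_zero (H.curv_sub_ne hx.1.1 hx.1.2)
  have sΘ := fun a => ((contDiffOn_const (c := δ / 2)).mul
    (((sϖ a).mul (c1.add c2)).sub ((d1 a).add (d2 a)))).sub (((sΦ a).mul c1).mul c2)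
  refine ⟨_, _, _, contDiffOn_pi.2 sϖ, contDiffOn_pi.2 sΦ, contDiffOn_pi.2 sΘ,
    fun x hx a p q r s => ?_⟩
  have hne := H.curv_sub_ne hx.1.1 hx.1.2
  -- Holds also where κ₁ = 0: there κ₁ vanishes locally, so both sides are 0.
  have e1 : u₁ x a * warpCurv (r₀ ^ 2 / L₀) ξ (x 1) =
      coordForm 1 (deriv (warpCurv (r₀ ^ 2 / L₀) ξ)) x a := by
    simp only [hu₁, coordForm, ite_mul, zero_mul, (n1 x hx).logDeriv_mul]
  have e2 : u₂ x a * warpCurv (r₀ ^ 2) h (x 2) =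
      coordForm 2 (deriv (warpCurv (r₀ ^ 2) h)) x a := by
    simp only [hu₂, coordForm, ite_mul, zero_mul, (n2 x hx).logDeriv_mul]
  rw [H.covDeriv_cntm (hsub hx) rfl rfl hT a p q r s rfl rfl, hT x (hsub hx),
    kulkarniNomizu_metric_metric p q r s rfl rfl,
    H.kulkarniNomizu_ricci_ricci (hsub hx) p q r s rfl rfl rfl rfl]
  simp only [Pi.div_apply, ← e1, ← e2]
  field_simp
  ring

/-- The three products are symmetric in EF and FE, so the difference of those coefficients forces Π
= (dκ₁ - dκ₂)/(κ₁ - κ₂). Then e = dκ₁ - Πκ₁ = dκ₂ - Πκ₂, and the remainder is e times ⅔(EE + FF) -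
⅓(EF + FE), expressed through the identity for E ∧ F used in `isRoterTypeOn`. No division by κ₁ or
κ₂ occurs, so U_S suffices. -/
theorem isSuperGenRecurrentOn_projective (H : IsWarpedData r₀ L₀ I J ξ h) :
    IsSuperGenRecurrentOn (cntm r₀ L₀ ξ h) (projective (cntm r₀ L₀ ξ h))
      {x ∈ chartDomain I J | einsteinDefect L₀ ξ h x ≠ 0} := by
  have hsub : {x ∈ chartDomain I J | einsteinDefect L₀ ξ h x ≠ 0} ⊆ chartDomain I J :=
    fun _ hx => hx.1
  have c1 := H.contDiffOn_left_curv_coord.mono hsub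
  have c2 := H.contDiffOn_right_curv_coord.mono hsub
  have d1 := fun a => (H.contDiffOn_left_form a).mono hsub
  have d2 := fun a => (H.contDiffOn_right_form a).mono hsub
  have sϖ := fun a => ((d1 a).sub (d2 a)).div (c1.sub c2) fun x hx => H.curv_sub_ne hx.1 hx.2
  have se := fun a => (d1 a).sub ((sϖ a).mul c1)
  have sΦ := fun a => (se a).div ((c1.sub c2).pow 2)
    fun x hx => pow_ne_zero 2 (H.curv_sub_ne hx.1 hx.2)
  have sΨ := fun a => ((sΦ a).mul (c1.add c2)).neg
  have sΘ := fun a => ((se a).div_const 3).add (((sΦ a).mul c1).mul c2)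
  refine ⟨_, _, _, _, contDiffOn_pi.2 sϖ, contDiffOn_pi.2 sΦ, contDiffOn_pi.2 sΨ,
    contDiffOn_pi.2 sΘ, fun x ⟨hx, hd⟩ a p q r s => ?_⟩
  have hne := H.curv_sub_ne hx hd
  rw [H.covDeriv_cntm hx rfl rfl (fun y hy p q r s => H.projective_cntm hy p q r s rfl rfl rfl rfl)
    a p q r s rfl rfl, H.projective_cntm hx p q r s rfl rfl rfl rfl,
    kulkarniNomizu_metric_metric p q r s rfl rfl,
    H.kulkarniNomizu_metric_ricci hx p q r s rfl rfl rfl rfl,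
    H.kulkarniNomizu_ricci_ricci hx p q r s rfl rfl rfl rfl]
  simp only [Pi.div_apply]
  field_simp
  ring

/-- C is κ₁ + κ₂ times a parallel tensor, so Π = d log|κ₁ + κ₂|. -/
theorem isRecurrentOn_conformal (H : IsWarpedData r₀ L₀ I J ξ h) :
    IsRecurrentOn (cntm r₀ L₀ ξ h) (conformal (cntm r₀ L₀ ξ h))
      {x ∈ chartDomain I J | weylFactor L₀ ξ h x ≠ 0} := by
  have hsub : {x ∈ chartDomain I J | weylFactor L₀ ξ h x ≠ 0} ⊆ chartDomain I J :=
    fun _ hx => hx.1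
  have c1 := H.contDiffOn_left_curv_coord.mono hsub
  have c2 := H.contDiffOn_right_curv_coord.mono hsub
  have d1 := fun a => (H.contDiffOn_left_form a).mono hsub
  have d2 := fun a => (H.contDiffOn_right_form a).mono hsub
  refine ⟨_, contDiffOn_pi.2 fun a => ((d1 a).add (d2 a)).div (c1.add c2)
    fun x hx => H.curv_add_ne hx.1 hx.2, fun x ⟨hx, hd⟩ a p q r s => ?_⟩
  have hne := H.curv_add_ne hx hd
  rw [H.covDeriv_cntm hx rfl rfl (fun y hy p q r s => H.conformal_cntm hy p q r s rfl rfl rfl rfl)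
    a p q r s rfl rfl, H.conformal_cntm hx p q r s rfl rfl rfl rfl]
  simp only [Pi.div_apply]
  field_simp
  ring
end IsWarpedData
end SemiRiem

theorem mainTheorem2 (r₀ L₀ : ℝ) (hr₀ : 0 < r₀) (hL₀ : 0 < L₀) (hL₀' : L₀ ≤ 1)
    (I J : Set ℝ) (hI : IsOpen I) (hJ : IsOpen J) (ξ h : ℝ → ℝ)
    (hξ : ContDiffOn ℝ ∞ ξ I) (hh : ContDiffOn ℝ ∞ h J)
    (hξ0 : ∀ r ∈ I, ξ r ≠ 0) (hh0 : ∀ θ ∈ J, h θ ≠ 0)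
    (g : SemiRiem.Tensor2 4) (hg : g = SemiRiem.cntm r₀ L₀ ξ h)
    (M US UC V : Set (SemiRiem.Pt 4)) (hM : M = SemiRiem.chartDomain I J)
    (hUS : US = {x ∈ M | SemiRiem.einsteinDefect L₀ ξ h x ≠ 0})
    (hUC : UC = {x ∈ M | SemiRiem.weylFactor L₀ ξ h x ≠ 0})
    (hV : V = {x ∈ US | SemiRiem.NonzeroOrLocallyZeroAt (deriv (deriv ξ)) (x 1) ∧
      SemiRiem.NonzeroOrLocallyZeroAt (deriv (deriv h)) (x 2)}) :
    (SemiRiem.IsSemisymmetricOn g (SemiRiem.riemann g) (SemiRiem.riemann g) M ∧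
      SemiRiem.IsPseudosymmetricOn g (SemiRiem.conformal g) g (SemiRiem.riemann g) M) ∧
    (SemiRiem.IsQuasiEinsteinOn 2 g US ∧
      SemiRiem.IsGenQuasiEinsteinOn g M ∧
      SemiRiem.IsRoterTypeOn g US) ∧
    (SemiRiem.IsSpecialSuperGenRecurrentOn g (SemiRiem.riemann g) V ∧
      SemiRiem.IsSuperGenRecurrentOn g (SemiRiem.projective g) US) ∧
    (SemiRiem.IsRecurrentOn g (SemiRiem.conformal g) UC ∧
      SemiRiem.IsSpecialSuperGenRecurrentOn g (SemiRiem.concircular g) V) ∧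
    (SemiRiem.IsRicciCompatibleOn g (SemiRiem.riemann g) M ∧
      SemiRiem.IsRicciCompatibleOn g (SemiRiem.projective g) M) := by
  subst hg hV hUS hUC hM
  have H : SemiRiem.IsWarpedData r₀ L₀ I J ξ h :=
    ⟨hr₀.ne', hL₀.ne', hI, hJ, hξ, hh, hξ0, hh0⟩
  -- δ = 0 gives R. For W, δ = 1/6 because κ/12 = (κ₁ + κ₂)/6.
  refine ⟨⟨H.isSemisymmetricOn, H.isPseudosymmetricOn⟩,
    ⟨H.isQuasiEinsteinOn, H.isGenQuasiEinsteinOn, H.isRoterTypeOn⟩,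
    ⟨H.isSpecialSuperGenRecurrentOn 0 fun y hy p q r s => ?_, H.isSuperGenRecurrentOn_projective⟩,
    ⟨H.isRecurrentOn_conformal, H.isSpecialSuperGenRecurrentOn (1 / 6) fun y hy p q r s => ?_⟩,
    H.isRicciCompatible_of_halfWedge fun x hx =>
      ⟨SemiRiem.warpCurv (r₀ ^ 2 / L₀) ξ (x 1), 0, SemiRiem.warpCurv (r₀ ^ 2) h (x 2),
        fun p q r s => ?_⟩,
    H.isRicciCompatible_of_halfWedge fun x hx =>
      ⟨2 / 3 * SemiRiem.warpCurv (r₀ ^ 2 / L₀) ξ (x 1), -1 / 3,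
        2 / 3 * SemiRiem.warpCurv (r₀ ^ 2) h (x 2), fun p q r s => ?_⟩⟩
  · rw [H.riemann_cntm hy]
    ring
  · rw [H.concircular_cntm hy p q r s rfl rfl rfl rfl]
    ring
  · rw [H.riemann_cntm hx]
    ring
  · rw [H.projective_cntm hx p q r s rfl rfl rfl rfl]
    ring
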